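/- An ordered $r$-graph is an $r$-uniform hypergraph whose vertex set is totally ordered. For ordered $r$-graphs $G,F$, say that $G$ is $F$-free if no subgraph of $G$ is isomorphic to $F$ by an isomorphism preserving the order of the vertices, and let $\mathrm{ex}_<(n,F)$ be the maximum number of edges in an $F$-free ordered $r$-graph on $n$ vertices. An ordered $r$-matching is an ordered $r$-graph in which every vertex lies in exactly one edge; its size is its number of edges. An $r$-pattern $P$ is an ordered $r$-matching of size $2$; it is represented by a word in the letters A and B that starts with A, the positions of each letter forming one edge. It is $r$-partite if, when its $2r$ vertices are divided into $r$ consecutive blocks of length $2$, each of its two edges has exactly one vertex in each block. A $P$-clique is an ordered $r$-matching in which every two distinct edges form an ordered hypergraph order-isomorphic to $P$; for an $r$-partite $r$-pattern $P$ and $m\ge 1$, let $P^{(m)}$ be the (unique) $P$-clique of size $m$ on the vertex set $\{1,\dots,rm\}$. Write $(x)_+=\max(x,0)$. **Theorem.** 1. For all integers $r,n,m\ge 1$ and every $r$-partite $r$-pattern $P$, $$\mathrm{ex}_<(n,P^{(m)})\ \ge\ \binom nr-\binom{(n-r(m-1))_+}{r}.$$ 2. There is an absolute constant $C>0$ such that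 for every $r\ge 1$ there is $n_0=n_0(r)$ such that for all $n\ge n_0$, all $m\ge 1$ and every $r$-partite $r$-pattern $P$, $$\mathrm{ex}_<(n,P^{(m)})\ \le\ C\,r^2(m-1)\binom{n}{r-1}.$$ 3. If $r,n,m\ge 1$ and $P$ is the alternating $r$-pattern $|AB|BA|AB|BA|\cdots|$ (with $r$ blocks, alternately $AB$ and $BA$, starting with $AB$), then $$\mathrm{ex}_<(n,P^{(m)})\ =\ \binom nr-\binom{(n-r(m-1))_+}{r}.$$ -/

import Mathlib

namespace OrdHyp

/-- An ordered `r`-uniform hypergraph with `n` vertices. The vertex set is taken to be `Fin n`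
with its usual order (every finite totally ordered set with `n` elements is uniquely
order-isomorphic to it). -/
@[ext]
structure OrderedGraph (r n : ℕ) where
  /-- the edge set -/
  edges : Finset (Finset (Fin n))
  uniform : ∀ e ∈ edges, e.card = r

variable {r n k : ℕ}

/-- `G.Contains F`: some (not necessarily induced) subgraph of `G` is isomorphic to `F` through an
isomorphism that preserves the order of the vertices. -/
def OrderedGraph.Contains (G : OrderedGraph r n) (F : OrderedGraph r k) : Prop :=
  ∃ φ : Fin k ↪o Fin n, ∀ e ∈ F.edges, e.map φ.toEmbedding ∈ G.edges

/-- `G` is `F`-free. -/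
def OrderedGraph.Free (G : OrderedGraph r n) (F : OrderedGraph r k) : Prop :=
  ¬ G.Contains F

/-- The ordered extremal number: the maximum number of edges in an `F`-free ordered `r`-graph with
`n` vertices. The set is always bounded, and it is nonempty when `F` has an edge, so
that the supremum is a maximum; see `exOrd_isGreatest`. -/
noncomputable def exOrd (n : ℕ) (F : OrderedGraph r k) : ℕ :=
  sSup {t : ℕ | ∃ G : OrderedGraph r n, G.Free F ∧ G.edges.card = t}

/-- Every vertex is contained in exactly one edge. -/
def OrderedGraph.IsMatching (M : OrderedGraph r n) : Prop :=
  ∀ v : Fin n, ∃! e, e ∈ M.edges ∧ v ∈ e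

/-- For a matching `M` of size `N` (so with `r * N` vertices): when the vertex set is divided into
`r` contiguous intervals of equal length `N`, every edge has exactly one vertex in each interval. -/
def OrderedGraph.IsPartite (N : ℕ) (M : OrderedGraph r (r * N)) : Prop :=
  ∀ e ∈ M.edges, ∀ i : Fin r, ∃! v : Fin (r * N),
    v ∈ e ∧ (i : ℕ) * N ≤ (v : ℕ) ∧ (v : ℕ) < ((i : ℕ) + 1) * N

/-- An `r`-pattern is an `r`-matching of size 2. -/
def OrderedGraph.IsPattern (P : OrderedGraph r (r * 2)) : Prop :=
  P.IsMatching ∧ P.edges.card = 2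

/-- The ordered hypergraph with the two edges `e` and `f` and with vertex set `e ∪ f` is isomorphic
to `P` through an order-preserving isomorphism. -/
def FormsPattern (P : OrderedGraph r (r * 2)) (e f : Finset (Fin n)) : Prop :=
  ∃ φ : Fin (r * 2) ↪o Fin n,
    Finset.univ.map φ.toEmbedding = e ∪ f ∧
      P.edges.image (fun a => a.map φ.toEmbedding) = {e, f}

/-- `Q` is a `P`-clique of size `m` on the vertex set `{0, …, rm - 1}`: an `r`-matching with `m`
edges in which every pair of edges is order-isomorphic to `P`. -/
def IsClique (P : OrderedGraph r (r * 2)) (m : ℕ) (Q : OrderedGraph r (r * m)) :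
    Prop :=
  Q.IsMatching ∧ Q.edges.card = m ∧
    ∀ e ∈ Q.edges, ∀ f ∈ Q.edges, e ≠ f → FormsPattern P e f

/-- The set of vertices with exactly one vertex `i * m + c i` in each interval
`{i * m, …, i * m + m - 1}`, `i < r`. -/
def transversal (r m : ℕ) (c : Fin r → Fin m) : Finset (Fin (r * m)) :=
  Finset.univ.image fun i => finProdFinEquiv (i, c i)

theorem card_transversal (m : ℕ) (c : Fin r → Fin m) : (transversal r m c).card = r := by
  unfold transversal
  rw [Finset.card_image_of_injective, Finset.card_univ, Fintype.card_fin]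
  intro i j h
  simpa using congrArg Prod.fst (finProdFinEquiv.injective h)

/-- The alternating `r`-pattern `|AB|BA|AB|BA|⋯|`. The `i`-th block (`i = 0, …, r - 1`) is
`{2i, 2i + 1}`; the edge `A` takes its first vertex if `i` is even and its second one if `i` is odd,
and the edge `B` takes the other vertex. -/
def alternatingPattern (r : ℕ) : OrderedGraph r (r * 2) where
  edges := {transversal r 2 (fun i => if Even (i : ℕ) then 0 else 1),
    transversal r 2 (fun i => if Even (i : ℕ) then 1 else 0)}
  uniform := by
    intro e he
    rcases Finset.mem_insert.1 he with rfl | he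
    · exact card_transversal _ _
    · rw [Finset.mem_singleton.1 he]
      exact card_transversal _ _

theorem exOrd_isGreatest (n : ℕ) (F : OrderedGraph r k) (hF : F.edges.Nonempty) :
    IsGreatest {t : ℕ | ∃ G : OrderedGraph r n, G.Free F ∧ G.edges.card = t} (exOrd n F) := by
  have hb : BddAbove {t : ℕ | ∃ G : OrderedGraph r n, G.Free F ∧ G.edges.card = t} := by
    refine ⟨Fintype.card (Finset (Fin n)), ?_⟩
    rintro t ⟨G, -, rfl⟩
    exact Finset.card_le_univ _
  have hne : {t : ℕ | ∃ G : OrderedGraph r n, G.Free F ∧ G.edges.card = t}.Nonempty := by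
    refine ⟨0, ⟨∅, by simp⟩, ?_, by simp⟩
    rintro ⟨φ, hφ⟩
    obtain ⟨e, he⟩ := hF
    simpa using hφ e he
  exact ⟨Nat.sSup_mem hne hb, fun t ht => le_csSup hb ht⟩

theorem mem_transversal {m : ℕ} {c : Fin r → Fin m} {v : Fin (r * m)} :
    v ∈ transversal r m c ↔ (finProdFinEquiv.symm v).2 = c (finProdFinEquiv.symm v).1 := by
  unfold transversal
  simp only [Finset.mem_image, Finset.mem_univ, true_and]
  constructor
  · rintro ⟨i, rfl⟩; simp
  · intro h
    refine ⟨(finProdFinEquiv.symm v).1, ?_⟩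
    rw [← h]
    exact finProdFinEquiv.apply_symm_apply v

theorem mk_mem_transversal {m : ℕ} {c : Fin r → Fin m} {i : Fin r} {x : Fin m} :
    finProdFinEquiv (i, x) ∈ transversal r m c ↔ x = c i := by
  rw [mem_transversal, Equiv.symm_apply_apply]

theorem transversal_inj {m : ℕ} {c d : Fin r → Fin m} (h : transversal r m c = transversal r m d) :
    c = d := by
  funext i
  have : finProdFinEquiv (i, c i) ∈ transversal r m d := by
    rw [← h, mk_mem_transversal]
  exact mk_mem_transversal.1 this

theorem exists_transversal {P : OrderedGraph r (r * k)} (h : P.IsPartite k) {e : Finset (Fin (r * k))}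
    (he : e ∈ P.edges) : ∃ a, e = transversal r k a := by
  have h1 : ∀ i : Fin r, ∃ x : Fin k, finProdFinEquiv (i, x) ∈ e := by
    intro i
    obtain ⟨v, ⟨hv, h1, h2⟩, -⟩ := h e he i
    obtain ⟨⟨j, x⟩, rfl⟩ := finProdFinEquiv.surjective v
    have : j = i := by
      simp only [finProdFinEquiv_apply_val] at h1 h2
      have := x.2
      apply Fin.ext
      apply le_antisymm
      · by_contra! hh
        have : ((i : ℕ) + 1) * k ≤ k * j := by rw [mul_comm k]; exact Nat.mul_le_mul_right _ hh
        omega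
      · by_contra! hh
        have : ((j : ℕ) + 1) * k ≤ i * k := Nat.mul_le_mul_right _ hh
        have h3 : ((j : ℕ) + 1) * k = k * j + k := by ring
        omega
    subst this
    exact ⟨x, hv⟩
  choose a ha using h1
  refine ⟨a, (Finset.eq_of_subset_of_card_le ?_ ?_).symm⟩
  · intro v hv
    obtain ⟨i, -, rfl⟩ := Finset.mem_image.1 hv
    exact ha i
  · rw [card_transversal, P.uniform e he]

theorem pattern_eq {P : OrderedGraph r (r * 2)} (hP : P.IsPattern) (h : P.IsPartite 2) :
    ∃ a : Fin r → Fin 2,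
      P.edges = {transversal r 2 a, transversal r 2 (fun i => (a i).rev)} := by
  obtain ⟨e, f, hef, hE⟩ := Finset.card_eq_two.1 hP.2
  have he : e ∈ P.edges := by simp [hE]
  have hf : f ∈ P.edges := by simp [hE]
  obtain ⟨a, ha⟩ := exists_transversal h he
  obtain ⟨b, hb⟩ := exists_transversal h hf
  refine ⟨a, ?_⟩
  have : b = fun i => (a i).rev := by
    funext i
    have : b i ≠ a i := by
      intro hi
      refine hef ((hP.1 (finProdFinEquiv (i, a i))).unique ⟨he, ?_⟩ ⟨hf, ?_⟩)
      · rw [ha, mk_mem_transversal]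
      · rw [hb, mk_mem_transversal, hi]
    have h1 := (a i).2
    have h2 := (b i).2
    rw [Ne, Fin.ext_iff] at this
    rw [Fin.ext_iff, Fin.val_rev]
    omega
  rw [hE, ← this, ha, hb]

/-- The notion of `P`-clique is not void: cliques of every size exist for every partite pattern. -/
theorem exists_isClique {P : OrderedGraph r (r * 2)} (hr : 1 ≤ r) (hP : P.IsPattern)
    (h : P.IsPartite 2) (m : ℕ) : ∃ Q, IsClique P m Q := by
  obtain ⟨a, ha⟩ := pattern_eq hP h
  let g : Fin m → Fin r → Fin m := fun j i => if a i = 0 then j else j.rev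
  have gg : ∀ j j' i, g j i = g j' i → j = j' := by
    intro j j' i hij
    simp only [g] at hij
    split_ifs at hij with hh
    · exact hij
    · exact Fin.rev_injective hij
  have ginj : Function.Injective fun j => transversal r m (g j) := fun j j' hj =>
    gg j j' ⟨0, hr⟩ (congrFun (transversal_inj hj) _)
  have symm : ∀ {e f : Finset (Fin (r * m))}, FormsPattern P e f → FormsPattern P f e := by
    rintro e f ⟨φ, h1, h2⟩
    exact ⟨φ, by rw [h1, Finset.union_comm], by rw [h2, Finset.pair_comm]⟩
  have key : ∀ j j' : Fin m, j < j' →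
      FormsPattern P (transversal r m (g j)) (transversal r m (g j')) := by
    intro j j' hj
    let ψ : Fin (r * 2) → Fin (r * m) := fun v =>
      finProdFinEquiv ((finProdFinEquiv.symm v).1,
        g (if (finProdFinEquiv.symm v).2 = a (finProdFinEquiv.symm v).1 then j else j')
          (finProdFinEquiv.symm v).1)
    have hψ : ∀ i x, ψ (finProdFinEquiv (i, x)) =
        finProdFinEquiv (i, g (if x = a i then j else j') i) := by
      intro i x; simp only [ψ, Equiv.symm_apply_apply]
    have mono : StrictMono ψ := by
      intro v w hvw
      obtain ⟨⟨i, x⟩, rfl⟩ := finProdFinEquiv.surjective v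
      obtain ⟨⟨i', x'⟩, rfl⟩ := finProdFinEquiv.surjective w
      rw [hψ, hψ]
      rw [Fin.lt_def, finProdFinEquiv_apply_val, finProdFinEquiv_apply_val] at hvw ⊢
      dsimp only at hvw ⊢
      rcases lt_trichotomy i i' with hi | hi | hi
      · have h1 := (g (if x = a i then j else j') i).2
        have h2 : m * (i + 1) ≤ m * i' := Nat.mul_le_mul_left _ hi
        rw [mul_add] at h2
        omega
      · subst hi
        have hx : (x : ℕ) = 0 ∧ (x' : ℕ) = 1 := by omega
        have hx0 : x = 0 := Fin.ext hx.1
        have hx1 : x' = 1 := Fin.ext hx.2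
        subst hx0 hx1
        have hj' : (j : ℕ) < j' := hj
        have hj2 := j'.2
        by_cases hai : a i = 0
        · simp only [g, hai]
          simpa using hj'
        · have hai : a i = 1 := by omega
          simp [g, hai, Fin.val_rev]
          omega
      · have h2 : (i' : ℕ) + 1 ≤ i := hi
        omega
    have im1 : (transversal r 2 a).map (OrderEmbedding.ofStrictMono ψ mono).toEmbedding
        = transversal r m (g j) := by
      rw [Finset.map_eq_image]
      unfold transversal
      rw [Finset.image_image]
      apply Finset.image_congr
      intro i _
      simp [hψ]
    have im2 : (transversal r 2 (fun i => (a i).rev)).map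
        (OrderEmbedding.ofStrictMono ψ mono).toEmbedding = transversal r m (g j') := by
      rw [Finset.map_eq_image]
      unfold transversal
      rw [Finset.image_image]
      apply Finset.image_congr
      intro i _
      have : (a i).rev ≠ a i := by
        intro h; rw [Fin.ext_iff, Fin.val_rev] at h; omega
      simp [hψ, this]
    refine ⟨OrderEmbedding.ofStrictMono ψ mono, ?_, ?_⟩
    · rw [← im1, ← im2, ← Finset.map_union]
      congr 1
      ext v
      obtain ⟨⟨i, x⟩, rfl⟩ := finProdFinEquiv.surjective v
      simp only [Finset.mem_univ, Finset.mem_union, mk_mem_transversal, true_iff]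
      by_cases hx : x = a i
      · exact Or.inl hx
      · right
        rw [Fin.ext_iff] at hx ⊢
        rw [Fin.val_rev]
        omega
    · rw [ha, Finset.image_insert, Finset.image_singleton, im1, im2]
  refine ⟨⟨Finset.univ.image fun j => transversal r m (g j), ?_⟩, ?_, ?_, ?_⟩
  · intro e he
    obtain ⟨j, -, rfl⟩ := Finset.mem_image.1 he
    exact card_transversal _ _
  · intro v
    obtain ⟨⟨i, x⟩, rfl⟩ := finProdFinEquiv.surjective v
    obtain ⟨j, hj⟩ : ∃ j, x = g j i := by
      by_cases hai : a i = 0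
      · exact ⟨x, by simp [g, hai]⟩
      · exact ⟨x.rev, by simp [g, hai]⟩
    refine ⟨transversal r m (g j), ⟨by simp, mk_mem_transversal.2 hj⟩, ?_⟩
    rintro e ⟨he, hv⟩
    obtain ⟨j', -, rfl⟩ := Finset.mem_image.1 he
    rw [mk_mem_transversal, hj] at hv
    rw [gg _ _ _ hv]
  · rw [Finset.card_image_of_injective _ ginj, Finset.card_univ, Fintype.card_fin]
  · intro e he f hf hne
    obtain ⟨j, -, rfl⟩ := Finset.mem_image.1 he
    obtain ⟨j', -, rfl⟩ := Finset.mem_image.1 hf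
    rcases lt_trichotomy j j' with hj | hj | hj
    · exact key j j' hj
    · exact absurd (by rw [hj]) hne
    · exact symm (key j' j hj)

/-- The alternating pattern is an `r`-partite `r`-pattern. -/
theorem alternatingPattern_isPattern (hr : 1 ≤ r) :
    (alternatingPattern r).IsPattern ∧ (alternatingPattern r).IsPartite 2 := by
  refine ⟨⟨?_, ?_⟩, ?_⟩
  · intro v
    obtain ⟨⟨i, x⟩, rfl⟩ := finProdFinEquiv.surjective v
    unfold ExistsUnique
    simp only [alternatingPattern, Finset.mem_insert, Finset.mem_singleton]
    by_cases hx : x = if Even (i : ℕ) then 0 else 1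
    · refine ⟨_, ⟨Or.inl rfl, mk_mem_transversal.2 hx⟩, ?_⟩
      rintro e ⟨rfl | rfl, he⟩
      · rfl
      · rw [mk_mem_transversal, hx] at he
        split_ifs at he <;> simp at he
    · refine ⟨_, ⟨Or.inr rfl, mk_mem_transversal.2 ?_⟩, ?_⟩
      · split_ifs at hx ⊢ <;> omega
      rintro e ⟨rfl | rfl, he⟩
      · rw [mk_mem_transversal] at he
        exact absurd he hx
      · rfl
  · apply Finset.card_pair
    intro h
    have := congrFun (transversal_inj h) ⟨0, hr⟩
    simp at this
  · intro e he i
    have : ∃ c : Fin r → Fin 2, e = transversal r 2 c := by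
      simp only [alternatingPattern, Finset.mem_insert, Finset.mem_singleton] at he
      rcases he with rfl | rfl
      · exact ⟨_, rfl⟩
      · exact ⟨_, rfl⟩
    obtain ⟨c, rfl⟩ := this
    refine ⟨finProdFinEquiv (i, c i), ⟨mk_mem_transversal.2 rfl, ?_, ?_⟩, ?_⟩
    · simp [finProdFinEquiv_apply_val]; omega
    · simp [finProdFinEquiv_apply_val]; omega
    · rintro v ⟨hv, h1, h2⟩
      obtain ⟨⟨j, x⟩, rfl⟩ := finProdFinEquiv.surjective v
      rw [mk_mem_transversal] at hv
      subst hv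
      simp only [finProdFinEquiv_apply_val] at h1 h2
      have : j = i := by apply Fin.ext; omega
      rw [this]

end OrdHyp

open OrdHyp

namespace OrdHyp

/-! Encode a partite pattern by signs `σ : Fin r → ℤ` with values ±1 and edges by increasing integer
tuples. A clique of size `m` is then a chain: `m` tuples whose `j`-th entries move in direction `σ
j`, with all `j`-th entries below all later ones (`HasChain`, `contains_iff_hasChain`).

Lower bound: the last edge of a clique of size `K + 1` leaves `K` forced vertices beside each of its
entries. Deleting these from the vertex set sends possible last edges injectively to `r`-subsets of
`n - r * K` points. Removing all possible last edges destroys every clique (`exists_free_graph`).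

Upper bound: tuples on a line of direction `σ` are monotone in the right directions, and they form a
chain as soon as all gaps exceed the distance travelled. At scale `h`, `slide` collapses segments of
length `h` of such lines, and a segment inside wide gaps holds at most `K` tuples. If one gap is
narrow, its two endpoints are allowed to vary independently. A chain is then found from a planar
fact: more than `K * (2 * N + 1)` pairs `a < b` in an interval of length `N` contain `K + 1`
pairwise crossing, and also `K + 1` pairwise nested, pairs with every `a` below every `b`
(`exists_signed_chain`). Tuples with two narrow gaps are classified dyadically by their second
smallest gap. Their count is proportional to the scale, so the sum is geometric and all cases
together give `O(r² K (n choose r - 1))` (`card_le_of_not_hasChain`).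

Nesting is a pigeonhole on `a + b`. Crossing uses an entropy count: weights on the given cells are
recovered, by the invertible Robinson–Schensted–Knuth growth rule, from `K` rows of `2 * N + 1`
boundary values when no large descent exists (`exists_descent`).

Alternating pattern: neighbouring entries move in opposite directions, so any tuples on one line
form a chain, however narrow the gaps. Each line thus contributes at most `K` edges, which is exact
after summation (`card_le_of_not_hasChain_alternating`). -/

/-! ### Last passage times and the Robinson–Schensted–Knuth growth rule -/

/-- Last passage times of the weights `w`: the largest weight of an up-right lattice path in
`[0, X) × [0, Y)`. -/
def lastPassage (w : ℕ → ℕ → ℕ) : ℕ → ℕ → ℕ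
  | 0, _ => 0
  | _ + 1, 0 => 0
  | X + 1, Y + 1 => max (lastPassage w X (Y + 1)) (lastPassage w (X + 1) Y) + w X Y

/-- The weights of the next row in the Robinson–Schensted–Knuth growth rule. -/
def derivedWeight (w : ℕ → ℕ → ℕ) (X Y : ℕ) : ℕ :=
  min (lastPassage w X (Y + 1)) (lastPassage w (X + 1) Y) - lastPassage w X Y

theorem iterate_derivedWeight_succ (w : ℕ → ℕ → ℕ) (j X Y : ℕ) : derivedWeight^[j + 1] w X Y =
    min (lastPassage (derivedWeight^[j] w) X (Y + 1)) (lastPassage (derivedWeight^[j] w) (X + 1) Y) -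
      lastPassage (derivedWeight^[j] w) X Y := by
  rw [Function.iterate_succ_apply']
  rfl

theorem lastPassage_zero_left (w : ℕ → ℕ → ℕ) (Y : ℕ) : lastPassage w 0 Y = 0 := by
  simp [lastPassage]

theorem lastPassage_zero_right (w : ℕ → ℕ → ℕ) (X : ℕ) : lastPassage w X 0 = 0 := by
  cases X <;> simp [lastPassage]

theorem lastPassage_succ (w : ℕ → ℕ → ℕ) (X Y : ℕ) : lastPassage w (X + 1) (Y + 1) =
    max (lastPassage w X (Y + 1)) (lastPassage w (X + 1) Y) + w X Y := by
  rw [lastPassage]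

theorem lastPassage_le_left (w : ℕ → ℕ → ℕ) (X Y : ℕ) :
    lastPassage w X Y ≤ lastPassage w (X + 1) Y := by
  cases Y with
  | zero => simp [lastPassage_zero_right]
  | succ Y => rw [lastPassage_succ]; omega

theorem lastPassage_le_right (w : ℕ → ℕ → ℕ) (X Y : ℕ) :
    lastPassage w X Y ≤ lastPassage w X (Y + 1) := by
  cases X with
  | zero => simp [lastPassage_zero_left]
  | succ X => rw [lastPassage_succ]; omega

theorem lastPassage_mono (w : ℕ → ℕ → ℕ) {X X' Y Y' : ℕ} (hX : X ≤ X') (hY : Y ≤ Y') :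
    lastPassage w X Y ≤ lastPassage w X' Y' :=
  (monotone_nat_of_le_succ (fun x => lastPassage_le_left w x Y) hX).trans
    (monotone_nat_of_le_succ (fun y => lastPassage_le_right w X' y) hY)

theorem derivedWeight_pos {w : ℕ → ℕ → ℕ} {X Y : ℕ} (h : 0 < derivedWeight w X Y) :
    lastPassage w X Y < lastPassage w X (Y + 1) ∧ lastPassage w X Y < lastPassage w (X + 1) Y := by
  unfold derivedWeight at h
  omega

/-- Along a row without weights between columns `A` and `X`, the last passage time can only
increase from the row below or from the left of column `A`. -/
theorem lastPassage_row {w : ℕ → ℕ → ℕ} {A X Y : ℕ} (hA : A ≤ X)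
    (h0 : ∀ x, A ≤ x → x < X → w x Y = 0) :
    lastPassage w X (Y + 1) ≤ max (lastPassage w A (Y + 1)) (lastPassage w X Y) := by
  induction X, hA using Nat.le_induction with
  | base => exact le_max_left _ _
  | succ X hA ih =>
    have h1 := ih fun x hx hx' => h0 x hx (by omega)
    have h2 := lastPassage_le_left w X Y
    rw [lastPassage_succ, h0 X hA (by omega)]
    omega

theorem lastPassage_col {w : ℕ → ℕ → ℕ} {B X Y : ℕ} (hB : B ≤ Y)
    (h0 : ∀ y, B ≤ y → y < Y → w X y = 0) :
    lastPassage w (X + 1) Y ≤ max (lastPassage w (X + 1) B) (lastPassage w X Y) := by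
  induction Y, hB using Nat.le_induction with
  | base => exact le_max_left _ _
  | succ Y hB ih =>
    have h1 := ih fun y hy hy' => h0 y hy (by omega)
    have h2 := lastPassage_le_right w X Y
    rw [lastPassage_succ, h0 Y hB (by omega)]
    omega

theorem exists_left_of_derivedWeight_pos {w : ℕ → ℕ → ℕ} {X Y : ℕ}
    (h : 0 < derivedWeight w X Y) : ∃ x < X, 0 < w x Y := by
  by_contra! hc
  have := lastPassage_row (w := w) (A := 0) (X := X) (Y := Y) (by omega)
    fun x _ hx => by have := hc x hx; omega
  have h2 := (derivedWeight_pos h).1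
  rw [lastPassage_zero_left] at this
  omega

theorem exists_below_of_derivedWeight_pos {w : ℕ → ℕ → ℕ} {X Y : ℕ}
    (h : 0 < derivedWeight w X Y) : ∃ y < Y, 0 < w X y := by
  by_contra! hc
  have := lastPassage_col (w := w) (B := 0) (X := X) (Y := Y) (by omega)
    fun y _ hy => by have := hc y hy; omega
  have h2 := (derivedWeight_pos h).2
  rw [lastPassage_zero_right] at this
  omega

/-- If the bottom row and left column of the rectangle were free of weight, the increase at `(X₂,
Y₂)` would have to come from `(X₁, Y₂ + 1)` and the one at `(X₁, Y₁)` from `(X₁ + 1, Y₂)`.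
Monotonicity then makes each of the last passage times at `(X₁, Y₁)` and `(X₂, Y₂)` strictly smaller
than the other. -/
theorem exists_between_of_derivedWeight_pos {w : ℕ → ℕ → ℕ} {X₁ Y₁ X₂ Y₂ : ℕ}
    (h₁ : 0 < derivedWeight w X₁ Y₁) (h₂ : 0 < derivedWeight w X₂ Y₂) (hX : X₁ < X₂)
    (hY : Y₂ < Y₁) : ∃ x y, X₁ ≤ x ∧ x < X₂ ∧ Y₂ ≤ y ∧ y < Y₁ ∧ 0 < w x y := by
  by_contra! hc
  have h0 : ∀ x y, X₁ ≤ x → x < X₂ → Y₂ ≤ y → y < Y₁ → w x y = 0 := fun x y a b c d =>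
    Nat.le_zero.1 (hc x y a b c d)
  have a1 := lastPassage_row (w := w) (Y := Y₂) hX.le fun x hx hx' => h0 x Y₂ hx hx' le_rfl hY
  have a2 := lastPassage_col (w := w) (X := X₁) hY.le fun y hy hy' => h0 X₁ y le_rfl hX hy hy'
  have a3 := (derivedWeight_pos h₁).2
  have a4 := (derivedWeight_pos h₂).1
  have a5 : lastPassage w (X₁ + 1) Y₂ ≤ lastPassage w X₂ Y₂ := lastPassage_mono w hX le_rfl
  have a6 : lastPassage w X₁ (Y₂ + 1) ≤ lastPassage w X₁ Y₁ := lastPassage_mono w le_rfl hY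
  omega

/-- `DescendsTo w B j x y`: there are `j + 1` cells of positive weight, with increasing first and
decreasing second coordinates, all the latter less than `B`, and the last cell is `(x, y)`. -/
def DescendsTo (w : ℕ → ℕ → ℕ) (B : ℕ) : ℕ → ℕ → ℕ → Prop
  | 0, x, y => 0 < w x y ∧ y < B
  | j + 1, x, y => 0 < w x y ∧ ∃ x' y', x' < x ∧ y < y' ∧ DescendsTo w B j x' y'

theorem DescendsTo.pos {w : ℕ → ℕ → ℕ} {B j x y : ℕ} (h : DescendsTo w B j x y) : 0 < w x y := by
  cases j <;> exact h.1

/-- A descent of derived weights is interleaved with a descent of original ones: a cell to the left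
of the first, in its row, and then one between each two consecutive cells. -/
theorem DescendsTo.shift {w : ℕ → ℕ → ℕ} {B j X Y : ℕ}
    (h : DescendsTo (derivedWeight w) B j X Y) :
    ∃ x y, x < X ∧ Y ≤ y ∧ DescendsTo w B j x y := by
  induction j generalizing X Y with
  | zero =>
    obtain ⟨x, hx, hw⟩ := exists_left_of_derivedWeight_pos h.1
    exact ⟨x, Y, hx, le_rfl, hw, h.2⟩
  | succ j ih =>
    obtain ⟨hp, X', Y', hX, hY, h'⟩ := h
    obtain ⟨x', y', hx', hy', hd⟩ := ih h'
    obtain ⟨x, y, h1, h2, h3, h4, h5⟩ := exists_between_of_derivedWeight_pos h'.pos hp hX hY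
    exact ⟨x, y, h2, h3, h5, x', y', by omega, by omega, hd⟩

/-- A further cell below the last one makes each derivation cost one extra cell. The height bound
`B` and the last column `X` are both kept, so the spanned rectangle does not outgrow the original
one. -/
theorem DescendsTo.of_derivedWeight {w : ℕ → ℕ → ℕ} {B j X Y : ℕ}
    (h : DescendsTo (derivedWeight w) B j X Y) : ∃ y, DescendsTo w B (j + 1) X y := by
  obtain ⟨x, y, hx, hy, hd⟩ := h.shift
  obtain ⟨y', hy', hw⟩ := exists_below_of_derivedWeight_pos h.pos
  exact ⟨y', hw, x, y, hx, by omega, hd⟩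

theorem DescendsTo.of_iterate {w : ℕ → ℕ → ℕ} {B i j X Y : ℕ}
    (h : DescendsTo (derivedWeight^[i] w) B j X Y) : ∃ y, DescendsTo w B (j + i) X y := by
  induction i generalizing j Y with
  | zero => exact ⟨Y, h⟩
  | succ i ih =>
    rw [Function.iterate_succ_apply'] at h
    obtain ⟨y, hy⟩ := h.of_derivedWeight
    obtain ⟨y', hy'⟩ := ih hy
    exact ⟨y', by rwa [Nat.add_right_comm] at hy'⟩

theorem DescendsTo.exists_seq {w : ℕ → ℕ → ℕ} {B j x y : ℕ} (h : DescendsTo w B j x y) :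
    ∃ c : ℕ → ℕ × ℕ, c j = (x, y) ∧ (∀ t ≤ j, 0 < w (c t).1 (c t).2) ∧ (∀ t ≤ j, (c t).2 < B) ∧
      ∀ t < j, (c t).1 < (c (t + 1)).1 ∧ (c (t + 1)).2 < (c t).2 := by
  induction j generalizing x y with
  | zero =>
    refine ⟨fun _ => (x, y), rfl, fun _ _ => h.1, fun _ _ => h.2, fun t ht => by omega⟩
  | succ j ih =>
    obtain ⟨hp, x', y', hx, hy, h'⟩ := h
    obtain ⟨c, hc, h1, h2, h3⟩ := ih h'
    have hB : y' < B := by have := h2 j le_rfl; rwa [hc] at this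
    refine ⟨Function.update c (j + 1) (x, y), by simp, ?_, ?_, ?_⟩
    · intro t ht
      rcases ht.lt_or_eq with ht | rfl
      · rw [Function.update_of_ne ht.ne]; exact h1 t (by omega)
      · simpa using hp
    · intro t ht
      rcases ht.lt_or_eq with ht | rfl
      · rw [Function.update_of_ne ht.ne]; exact h2 t (by omega)
      · simp only [Function.update_self]; omega
    · intro t ht
      rw [Function.update_of_ne (show t ≠ j + 1 by omega)]
      rcases (Nat.lt_succ_iff.1 ht).lt_or_eq with ht | rfl
      · rw [Function.update_of_ne (show t + 1 ≠ j + 1 by omega)]; exact h3 t ht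
      · simp only [Function.update_self, hc]; exact ⟨hx, hy⟩

theorem lastPassage_eq_zero {w : ℕ → ℕ → ℕ} {X Y : ℕ} (h : ∀ x < X, ∀ y < Y, w x y = 0) :
    lastPassage w X Y = 0 := by
  induction X with
  | zero => exact lastPassage_zero_left w Y
  | succ X ih =>
    have h1 := lastPassage_col (w := w) (B := 0) (X := X) (Y := Y) (by omega)
      fun y _ hy => h X (by omega) y hy
    rw [lastPassage_zero_right, ih fun x hx => h x (by omega)] at h1
    omega

/-- The boundary values of all rows determine the weights. -/
theorem lastPassage_determines {w v : ℕ → ℕ → ℕ} {N : ℕ}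
    (h : ∀ j X Y, X + Y = N ∨ X + Y + 1 = N →
      lastPassage (derivedWeight^[j] w) X Y = lastPassage (derivedWeight^[j] v) X Y)
    {X Y : ℕ} (hXY : X + Y + 2 ≤ N) : w X Y = v X Y := by
  have key : ∀ d j X Y, (X + Y + d = N ∨ X + Y + d + 1 = N) →
      lastPassage (derivedWeight^[j] w) X Y = lastPassage (derivedWeight^[j] v) X Y := by
    intro d
    induction d with
    | zero => exact h
    | succ d ih =>
      intro j X Y hd
      rcases hd with hd | hd
      · exact ih j X Y (Or.inr (by omega))
      · have e1 := ih j X (Y + 1) (Or.inr (by omega))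
        have e2 := ih j (X + 1) Y (Or.inr (by omega))
        have e3 := ih (j + 1) X (Y + 1) (Or.inr (by omega))
        have e4 := ih (j + 1) (X + 1) Y (Or.inr (by omega))
        have e5 := ih (j + 1) (X + 1) (Y + 1) (Or.inl (by omega))
        -- The growth rule runs backwards: row `j + 1` at three corners gives its weight at `(X,
        -- Y)`, which is the minimum minus the missing corner of row `j`.
        rw [lastPassage_succ, lastPassage_succ, e3, e4] at e5
        have e6 := Nat.add_left_cancel e5
        rw [iterate_derivedWeight_succ, iterate_derivedWeight_succ, e1, e2] at e6
        have m1 := lastPassage_le_left (derivedWeight^[j] w) X Y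
        have m2 := lastPassage_le_right (derivedWeight^[j] w) X Y
        have m3 := lastPassage_le_left (derivedWeight^[j] v) X Y
        have m4 := lastPassage_le_right (derivedWeight^[j] v) X Y
        omega
  have e5 := key (N - (X + Y + 2)) 0 (X + 1) (Y + 1) (Or.inl (by omega))
  have e3 := key (N - (X + Y + 2)) 0 X (Y + 1) (Or.inr (by omega))
  have e4 := key (N - (X + Y + 2)) 0 (X + 1) Y (Or.inr (by omega))
  simp only [Function.iterate_zero, id_eq] at e3 e4 e5
  rw [lastPassage_succ, lastPassage_succ, e3, e4] at e5
  exact Nat.add_left_cancel e5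

theorem lastPassage_le {w : ℕ → ℕ → ℕ} {M : ℕ} {X Y : ℕ} (h : ∀ x y, x + y < X + Y → w x y ≤ M) :
    lastPassage w X Y ≤ (X + Y) * M := by
  induction X generalizing Y with
  | zero => simp [lastPassage_zero_left]
  | succ X ihX =>
    induction Y with
    | zero => simp [lastPassage_zero_right]
    | succ Y ihY =>
      have h1 := ihX (Y := Y + 1) fun x y hxy => h x y (by omega)
      have h2 := ihY fun x y hxy => h x y (by omega)
      have h3 := h X Y (by omega)
      have e1 : (X + 1 + (Y + 1)) * M = (X + Y + 1) * M + M := by ring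
      have e2 : (X + (Y + 1)) * M = (X + Y + 1) * M := by ring
      have e3 : (X + 1 + Y) * M = (X + Y + 1) * M := by ring
      rw [lastPassage_succ]
      omega

theorem iterate_derivedWeight_le {w : ℕ → ℕ → ℕ} {M N : ℕ} (h : ∀ x y, w x y ≤ M) (j : ℕ) {X Y : ℕ}
    (hXY : X + Y ≤ N) : derivedWeight^[j] w X Y ≤ (N + 1) ^ j * M := by
  induction j generalizing X Y with
  | zero => simpa using h X Y
  | succ j ih =>
    have h1 : lastPassage (derivedWeight^[j] w) X (Y + 1) ≤ (X + (Y + 1)) * ((N + 1) ^ j * M) :=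
      lastPassage_le fun x y hxy => ih (by omega)
    have h2 : (X + (Y + 1)) * ((N + 1) ^ j * M) ≤ (N + 1) * ((N + 1) ^ j * M) :=
      Nat.mul_le_mul_right _ (by omega)
    rw [iterate_derivedWeight_succ, pow_succ', mul_assoc]
    omega

/-- A set of more than `K * (2 * N + 1)` cells of the staircase shape `x + y + 2 ≤ N` contains
`K + 1` cells with increasing first and decreasing second coordinates that span a rectangle inside
the shape. -/
theorem exists_descent (S : Finset (ℕ × ℕ)) {N K : ℕ} (hS : ∀ p ∈ S, p.1 + p.2 + 2 ≤ N)
    (hcard : K * (2 * N + 1) < S.card) :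
    ∃ c : ℕ → ℕ × ℕ, (∀ t ≤ K, c t ∈ S) ∧
      (∀ t < K, (c t).1 < (c (t + 1)).1 ∧ (c (t + 1)).2 < (c t).2) ∧
      (c K).1 + (c 0).2 + 2 ≤ N := by
  by_contra hno
  -- `D` counts the boundary values of the first `K` rows, and `B * M` bounds each of them. The
  -- choice of `M` gives `(B * (M + 1)) ^ D = M * (M + 1) ^ D < (M + 1) ^ (D + 1)`, too few values
  -- to encode `D + 1` free weights.
  set D := K * (2 * N + 1)
  set B := (N + 1) ^ (K + 1)
  have hB : 0 < B := by positivity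
  set M := B ^ D
  let w : (S → Fin (M + 1)) → ℕ → ℕ → ℕ := fun f x y =>
    if h : (x, y) ∈ S then (f ⟨(x, y), h⟩ : ℕ) else 0
  have hwM : ∀ f x y, w f x y ≤ M := by
    intro f x y
    simp only [w]
    split_ifs with h
    · exact Nat.lt_succ_iff.1 (f _).2
    · exact Nat.zero_le _
  have hwS : ∀ f x y, 0 < w f x y → (x, y) ∈ S := by
    intro f x y h
    by_contra hc
    simp [w, hc] at h
  have hrow : ∀ f j X Y, K ≤ j → X + Y ≤ N → lastPassage (derivedWeight^[j] (w f)) X Y = 0 := by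
    intro f j X Y hj hXY
    refine lastPassage_eq_zero fun x hx y hy => ?_
    by_contra hpos
    obtain ⟨i, rfl⟩ := Nat.exists_eq_add_of_le hj
    have hd : DescendsTo (derivedWeight^[K] (derivedWeight^[i] (w f))) (y + 1) 0 x y := by
      rw [← Function.iterate_add_apply]
      exact ⟨Nat.pos_of_ne_zero hpos, by omega⟩
    obtain ⟨y₁, hy₁⟩ := hd.of_iterate
    obtain ⟨y₂, hy₂⟩ := hy₁.of_iterate
    obtain ⟨c, hc1, hc2, hc3, hc4⟩ := hy₂.exists_seq
    -- The descent has `K + i + 1` cells; its first `K + 1` suffice. They end no further right than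
    -- `x` and start no higher than `y`.
    refine hno ⟨c, fun t ht => hwS f _ _ (hc2 t (by omega)), fun t ht => hc4 t (by omega), ?_⟩
    have hle : ∀ t, t ≤ i → (c K).1 ≤ (c (K + t)).1 := by
      intro t
      induction t with
      | zero => simp
      | succ t ih =>
        intro ht
        have h1 := ih (by omega)
        have h2 := (hc4 (K + t) (by omega)).1
        rw [← add_assoc]
        omega
    have h1 := hle i le_rfl
    rw [show K + i = 0 + K + i by omega, hc1] at h1
    have h2 := hc3 0 (by omega)
    dsimp only at h1
    omega
  have hbound : ∀ f j X Y, j < K → X + Y ≤ N →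
      lastPassage (derivedWeight^[j] (w f)) X Y < B * M + 1 := by
    intro f j X Y hj hXY
    have h1 : lastPassage (derivedWeight^[j] (w f)) X Y ≤ (X + Y) * ((N + 1) ^ j * M) :=
      lastPassage_le fun x y hxy => iterate_derivedWeight_le (hwM f) j (by omega)
    have h2 : (X + Y) * ((N + 1) ^ j * M) ≤ (N + 1) * ((N + 1) ^ j * M) :=
      Nat.mul_le_mul_right _ (by omega)
    have h3 : (N + 1) * ((N + 1) ^ j * M) ≤ B * M := by
      rw [← mul_assoc, ← pow_succ']
      exact Nat.mul_le_mul_right _ (Nat.pow_le_pow_right (by omega) (by omega))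
    omega
  -- The boundary consists of the `N + 1` points with `X + Y = N` and the `N` points with `X + Y + 1
  -- = N`.
  let Φ : (S → Fin (M + 1)) → (Fin K × (Fin (N + 1) ⊕ Fin N) → Fin (B * M + 1)) := fun f q =>
    match q with
    | (j, Sum.inl X) => ⟨lastPassage (derivedWeight^[j] (w f)) X (N - X),
        hbound f j _ _ j.2 (by omega)⟩
    | (j, Sum.inr X) => ⟨lastPassage (derivedWeight^[j] (w f)) X (N - 1 - X),
        hbound f j _ _ j.2 (by omega)⟩
  have hΦ : Function.Injective Φ := by
    intro f g hfg
    have hdet : ∀ {X Y : ℕ}, X + Y + 2 ≤ N → w f X Y = w g X Y := by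
      refine lastPassage_determines ?_
      intro j X Y hXY
      by_cases hj : j < K
      · rcases hXY with hXY | hXY
        · have := congrFun hfg (⟨j, hj⟩, Sum.inl ⟨X, by omega⟩)
          simp only [Φ, Fin.mk.injEq] at this
          rwa [show N - X = Y by omega] at this
        · have := congrFun hfg (⟨j, hj⟩, Sum.inr ⟨X, by omega⟩)
          simp only [Φ, Fin.mk.injEq] at this
          rwa [show N - 1 - X = Y by omega] at this
      · rw [hrow f j X Y (by omega) (by omega), hrow g j X Y (by omega) (by omega)]
    funext ⟨⟨x, y⟩, hp⟩
    have := hdet (hS _ hp)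
    simp only [w, hp, dite_true] at this
    exact Fin.ext this
  have hc := Fintype.card_le_of_injective Φ hΦ
  simp only [Fintype.card_fun, Fintype.card_coe, Fintype.card_fin, Fintype.card_prod,
    Fintype.card_sum] at hc
  rw [show K * (N + 1 + N) = D by simp only [D]; ring] at hc
  have h1 : (M + 1) ^ (D + 1) ≤ (M + 1) ^ S.card := Nat.pow_le_pow_right (by omega) hcard
  have h2 : (B * M + 1) ^ D ≤ (B * (M + 1)) ^ D := by
    apply Nat.pow_le_pow_left
    rw [mul_add, mul_one]
    omega
  have h3 : (M + 1) * (M + 1) ^ D ≤ M * (M + 1) ^ D := by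
    rw [← pow_succ', show M * (M + 1) ^ D = (B * (M + 1)) ^ D by rw [mul_pow]]
    exact (h1.trans hc).trans h2
  have h4 := Nat.le_of_mul_le_mul_right h3 (by positivity)
  omega

/-! ### Crossing and nesting families of pairs -/

/-- Among more than `K * (2 * N + 1)` pairs `a < b` in an interval of length `N`, there are `K + 1`
pairwise crossing ones. -/
theorem exists_crossing (S : Finset (ℤ × ℤ)) {N K : ℕ}
    (hS : ∀ p ∈ S, 0 ≤ p.1 ∧ p.1 < p.2 ∧ p.2 < N) (hcard : K * (2 * N + 1) < S.card) :
    ∃ c : Fin (K + 1) → ℤ × ℤ, (∀ t, c t ∈ S) ∧ StrictMono (fun t => (c t).1) ∧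
      StrictMono (fun t => (c t).2) ∧ ∀ t t', (c t).1 < (c t').2 := by
  -- Reversing the second coordinate turns `a < b` into the staircase condition and crossing into
  -- descent. The spanned corner being in the shape says that the largest `a` is below the smallest
  -- `b`.
  let F : ℤ × ℤ → ℕ × ℕ := fun p => (p.1.toNat, (N - 1 - p.2).toNat)
  have hF : Set.InjOn F S := by
    intro p hp q hq h
    have h1 := hS p hp
    have h2 := hS q hq
    simp only [F, Prod.mk.injEq] at h
    exact Prod.ext (by omega) (by omega)
  obtain ⟨c, hc1, hc2, hc3⟩ := exists_descent (S.image F) (N := N) (K := K) (by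
    intro p hp
    obtain ⟨q, hq, rfl⟩ := Finset.mem_image.1 hp
    have := hS q hq
    simp only [F]
    omega) (by rwa [Finset.card_image_of_injOn hF])
  have hex : ∀ t : Fin (K + 1), ∃ p ∈ S, F p = c t := fun t =>
    Finset.mem_image.1 (hc1 t (by omega))
  choose d hd hdc using hex
  have e1 : ∀ t : Fin (K + 1), ((c t).1 : ℤ) = (d t).1 := by
    intro t
    have h1 := congrArg Prod.fst (hdc t)
    have h2 := hS _ (hd t)
    simp only [F] at h1
    omega
  have e2 : ∀ t : Fin (K + 1), ((c t).2 : ℤ) = N - 1 - (d t).2 := by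
    intro t
    have h1 := congrArg Prod.snd (hdc t)
    have h2 := hS _ (hd t)
    simp only [F] at h1
    omega
  have m1 : StrictMono (fun t => (d t).1) := by
    rw [Fin.strictMono_iff_lt_succ]
    intro t
    have h1 := e1 t.castSucc
    have h2 := e1 t.succ
    have h3 := hc2 t t.2
    simp only [Fin.val_castSucc, Fin.val_succ] at h1 h2
    omega
  have m2 : StrictMono (fun t => (d t).2) := by
    rw [Fin.strictMono_iff_lt_succ]
    intro t
    have h1 := e2 t.castSucc
    have h2 := e2 t.succ
    have h3 := hc2 t t.2
    simp only [Fin.val_castSucc, Fin.val_succ] at h1 h2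
    omega
  refine ⟨d, hd, m1, m2, fun t t' => ?_⟩
  have h1 : (d t).1 ≤ (d (Fin.last K)).1 := m1.monotone (Fin.le_last t)
  have h2 : (d 0).2 ≤ (d t').2 := m2.monotone (Fin.zero_le t')
  have h3 := e1 (Fin.last K)
  have h4 := e2 0
  simp only [Fin.val_last, Fin.val_zero] at h3 h4
  omega

/-- Among more than `K * (2 * N + 1)` pairs `a < b` in an interval of length `N`, there are `K + 1`
pairwise nested ones. -/
theorem exists_nesting (S : Finset (ℤ × ℤ)) {N K : ℕ}
    (hS : ∀ p ∈ S, 0 ≤ p.1 ∧ p.1 < p.2 ∧ p.2 < N) (hcard : K * (2 * N + 1) < S.card) :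
    ∃ c : Fin (K + 1) → ℤ × ℤ, (∀ t, c t ∈ S) ∧ StrictMono (fun t => (c t).1) ∧
      StrictAnti (fun t => (c t).2) ∧ ∀ t t', (c t).1 < (c t').2 := by
  -- Pairs with the same sum `s` are concentric, and all of them straddle `s / 2`.
  obtain ⟨s, -, hs⟩ := Finset.exists_lt_card_fiber_of_mul_lt_card_of_maps_to
    (s := S) (t := Finset.Icc (0 : ℤ) (2 * N)) (f := fun p => p.1 + p.2) (n := K) (by
      intro p hp
      have := hS p hp
      rw [Finset.mem_Icc]
      omega) (by
      rw [Int.card_Icc, mul_comm]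
      convert hcard using 2
      omega)
  set T := S.filter fun p => p.1 + p.2 = s
  have hT : ∀ p ∈ T, p ∈ S ∧ p.1 + p.2 = s := fun p hp => Finset.mem_filter.1 hp
  have hinj : Set.InjOn Prod.fst (T : Set (ℤ × ℤ)) := by
    intro p hp q hq h
    have h1 := hT p hp
    have h2 := hT q hq
    exact Prod.ext h (by omega)
  obtain ⟨U, hU, hUc⟩ := Finset.exists_subset_card_eq
    (show K + 1 ≤ (T.image Prod.fst).card by rw [Finset.card_image_of_injOn hinj]; exact hs)
  have hmem : ∀ t : Fin (K + 1), (U.orderEmbOfFin hUc t, s - U.orderEmbOfFin hUc t) ∈ S := by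
    intro t
    obtain ⟨p, hp, hpt⟩ := Finset.mem_image.1 (hU (U.orderEmbOfFin_mem hUc t))
    rw [← hpt, show s - p.1 = p.2 by have := (hT p hp).2; omega]
    exact (hT p hp).1
  have m1 : StrictMono fun t => U.orderEmbOfFin hUc t := (U.orderEmbOfFin hUc).strictMono
  refine ⟨_, hmem, m1, fun t t' h => ?_, fun t t' => ?_⟩
  · have := m1 h
    dsimp only at this ⊢
    omega
  · dsimp only
    have h1 := (hS _ (hmem t)).2.1
    have h2 := (hS _ (hmem t')).2.1
    dsimp only at h1 h2
    omega

/-- Equal signs ask for a crossing family and opposite signs for a nested one; listing the family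
backwards flips both signs. -/
theorem exists_signed_chain (S : Finset (ℤ × ℤ)) {N K : ℕ}
    (hS : ∀ p ∈ S, 0 ≤ p.1 ∧ p.1 < p.2 ∧ p.2 < N) (hcard : K * (2 * N + 1) < S.card) {σ τ : ℤ}
    (hσ : σ = 1 ∨ σ = -1) (hτ : τ = 1 ∨ τ = -1) :
    ∃ c : Fin (K + 1) → ℤ × ℤ, (∀ t, c t ∈ S) ∧ StrictMono (fun t => σ * (c t).1) ∧
      StrictMono (fun t => τ * (c t).2) ∧ ∀ t t', (c t).1 < (c t').2 := by
  obtain ⟨c, h1, h2, h3, h4⟩ := exists_crossing S hS hcard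
  obtain ⟨d, k1, k2, k3, k4⟩ := exists_nesting S hS hcard
  have r1 : StrictMono fun t => -1 * (c (Fin.rev t)).1 := fun t t' h => by
    have := h2 (Fin.rev_lt_rev.2 h); dsimp only at this ⊢; omega
  have r2 : StrictMono fun t => -1 * (c (Fin.rev t)).2 := fun t t' h => by
    have := h3 (Fin.rev_lt_rev.2 h); dsimp only at this ⊢; omega
  have r3 : StrictMono fun t => -1 * (d (Fin.rev t)).1 := fun t t' h => by
    have := k2 (Fin.rev_lt_rev.2 h); dsimp only at this ⊢; omega
  have r4 : StrictMono fun t => (d (Fin.rev t)).2 := fun t t' h => k3 (Fin.rev_lt_rev.2 h)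
  have r5 : StrictMono fun t => -1 * (d t).2 := fun t t' h => by
    have := k3 h; dsimp only at this ⊢; omega
  rcases hσ with rfl | rfl <;> rcases hτ with rfl | rfl
  · exact ⟨c, h1, by simpa using h2, by simpa using h3, h4⟩
  · exact ⟨d, k1, by simpa using k2, r5, k4⟩
  · exact ⟨fun t => d t.rev, fun t => k1 _, r3, by simpa using r4, fun t t' => k4 _ _⟩
  · exact ⟨fun t => c t.rev, fun t => h1 _, r1, r2, fun t t' => h4 _ _⟩

/-! ### Chains of tuples and sliding along the sign direction -/

variable {r : ℕ}

/-- `X` contains `m` tuples that form a clique of the pattern with the signs `σ`: the `j`-th entries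
increase if `σ j = 1` and decrease if `σ j = -1`, and all `j`-th entries are smaller than all
`j'`-th entries when `j < j'`. -/
def HasChain (σ : Fin r → ℤ) (m : ℕ) (X : Finset (Fin r → ℤ)) : Prop :=
  ∃ c : Fin m → Fin r → ℤ, (∀ t, c t ∈ X) ∧ (∀ j, StrictMono fun t => σ j * c t j) ∧
    ∀ j j', j < j' → ∀ t t', c t j < c t' j'

theorem HasChain.mono {σ : Fin r → ℤ} {m : ℕ} {X Y : Finset (Fin r → ℤ)} (h : HasChain σ m X)
    (hXY : X ⊆ Y) : HasChain σ m Y := by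
  obtain ⟨c, h1, h2⟩ := h
  exact ⟨c, fun t => hXY (h1 t), h2⟩

/-- Move the `i`-th entry down to a multiple of `h`, and the other entries along with it, in the
directions given by the signs. -/
def slide (σ : Fin r → ℤ) (h : ℕ) (i : Fin r) (x : Fin r → ℤ) (j : Fin r) : ℤ :=
  x j - σ j * σ i * (x i % h)

theorem slide_self {σ : Fin r → ℤ} (hσ : ∀ j, σ j = 1 ∨ σ j = -1) (h : ℕ) (i : Fin r)
    (x : Fin r → ℤ) : slide σ h i x i = h * (x i / h) := by
  have h1 : σ i * σ i = 1 := by rcases hσ i with h | h <;> simp [h]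
  have h2 := Int.mul_ediv_add_emod (x i) h
  rw [slide, h1]
  omega

/-- Used by subtracting two instances: when two tuples agree after sliding in entries `i` and `j`,
their signed displacements in these entries are equal. -/
theorem mul_slide {σ : Fin r → ℤ} (hσ : ∀ j, σ j = 1 ∨ σ j = -1) (h : ℕ) (i : Fin r)
    (x : Fin r → ℤ) (j : Fin r) :
    σ j * x j = σ j * slide σ h i x j + σ i * x i - σ i * slide σ h i x i := by
  have h1 : σ i * σ i = 1 := by rcases hσ i with h | h <;> simp [h]
  have h2 : σ j * σ j = 1 := by rcases hσ j with h | h <;> simp [h]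
  simp only [slide]
  linear_combination (σ i * (x i % h)) * h2 - (σ i * (x i % h)) * h1

theorem slide_bounds {σ : Fin r → ℤ} (hσ : ∀ j, σ j = 1 ∨ σ j = -1) {h : ℕ} (hh : 1 ≤ h) (i : Fin r)
    (x : Fin r → ℤ) (j : Fin r) :
    x j - (h - 1) ≤ slide σ h i x j ∧ slide σ h i x j ≤ x j + (h - 1) := by
  have h1 := Int.emod_nonneg (x i) (show (h : ℤ) ≠ 0 by omega)
  have h2 := Int.emod_lt_of_pos (x i) (show (0 : ℤ) < h by omega)
  simp only [slide]
  rcases hσ i with h | h <;> rcases hσ j with h' | h' <;> rw [h, h'] <;> constructor <;> linarith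

theorem lt_add_of_slide_eq {σ : Fin r → ℤ} (hσ : ∀ j, σ j = 1 ∨ σ j = -1) {h : ℕ} (hh : 1 ≤ h)
    {i : Fin r} {x x' : Fin r → ℤ} {j : Fin r} (hs : slide σ h i x j = slide σ h i x' j) :
    x' j < x j + h := by
  have h1 := Int.emod_nonneg (x i) (show (h : ℤ) ≠ 0 by omega)
  have h2 := Int.emod_lt_of_pos (x i) (show (0 : ℤ) < h by omega)
  have h3 := Int.emod_nonneg (x' i) (show (h : ℤ) ≠ 0 by omega)
  have h4 := Int.emod_lt_of_pos (x' i) (show (0 : ℤ) < h by omega)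
  simp only [slide] at hs
  rcases hσ i with h | h <;> rcases hσ j with h' | h' <;> rw [h, h'] at hs <;> linarith

/-- A fibre lies on a line of direction `σ`, and each entry varies by less than `h`, which the gaps
absorb. Hence any `K + 1` members form a chain. -/
theorem card_fibre_le {σ : Fin r → ℤ} (hσ : ∀ j, σ j = 1 ∨ σ j = -1) {h K : ℕ} (hh : 1 ≤ h)
    (i : Fin r) {E : Finset (Fin r → ℤ)}
    (hgap : ∀ x ∈ E, ∀ j j', j < j' → x j + h ≤ x j')
    (hE : ∀ x ∈ E, ∀ x' ∈ E, slide σ h i x = slide σ h i x')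
    (hno : ¬ HasChain σ (K + 1) E) : E.card ≤ K := by
  by_contra! hcard
  have hmul : ∀ x ∈ E, ∀ x' ∈ E, ∀ j, σ j * x j - σ j * x' j = σ i * x i - σ i * x' i := by
    intro x hx x' hx' j
    have h1 := mul_slide hσ h i x j
    have h2 := mul_slide hσ h i x' j
    rw [hE x hx x' hx'] at h1
    linarith
  have hinj : Set.InjOn (fun x : Fin r → ℤ => σ i * x i) (E : Set (Fin r → ℤ)) := by
    intro x hx x' hx' hxx
    funext j
    have h1 := hmul x hx x' hx' j
    dsimp only at hxx
    rcases hσ j with h | h <;> rw [h] at h1 <;> linarith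
  obtain ⟨U, hU, hUc⟩ := Finset.exists_subset_card_eq
    (show K + 1 ≤ (E.image fun x : Fin r → ℤ => σ i * x i).card by
      rwa [Finset.card_image_of_injOn hinj])
  have hmem : ∀ t : Fin (K + 1), ∃ x ∈ E, σ i * x i = U.orderEmbOfFin hUc t := fun t =>
    Finset.mem_image.1 (hU (U.orderEmbOfFin_mem hUc t))
  choose c hc hcU using hmem
  refine hno ⟨c, hc, fun j t t' htt => ?_, fun j j' hj t t' => ?_⟩
  · have h1 := hmul _ (hc t) _ (hc t') j
    have h2 := (U.orderEmbOfFin hUc).strictMono htt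
    rw [← hcU, ← hcU] at h2
    dsimp only
    linarith
  · have h1 := hgap _ (hc t) j j' hj
    have h2 := lt_add_of_slide_eq hσ hh (congrFun (hE _ (hc t') _ (hc t)) j')
    linarith

/-- With entry `k` left free, a member is determined by `(x i, x k)`, and the other entries move
rigidly with `x i`. A signed chain of these pairs therefore lifts to tuples. Earlier entries are
separated from entry `k` through entry `i`. -/
theorem card_fibre_le_of_close {σ : Fin r → ℤ} (hσ : ∀ j, σ j = 1 ∨ σ j = -1) {h K : ℕ}
    (hh : 1 ≤ h) {i k : Fin r} (hik : (k : ℕ) = i + 1) {E : Finset (Fin r → ℤ)}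
    (hgap : ∀ x ∈ E, ∀ j j', j < j' → j' ≠ k → x j + h ≤ x j')
    (hclose : ∀ x ∈ E, x i < x k ∧ x k ≤ x i + 4 * h)
    (hE : ∀ x ∈ E, ∀ x' ∈ E, ∀ j, j ≠ k → slide σ h i x j = slide σ h i x' j)
    (hno : ¬ HasChain σ (K + 1) E) : E.card ≤ 11 * K * h := by
  by_contra! hcard
  have hne : i ≠ k := fun h => by rw [h] at hik; omega
  obtain ⟨x₀, hx₀⟩ : E.Nonempty := Finset.card_pos.1 (by omega)
  set q := slide σ h i x₀ i
  have hq : ∀ x ∈ E, q ≤ x i ∧ x i < q + h := by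
    intro x hx
    have h1 := hE _ hx _ hx₀ i hne
    rw [slide_self hσ] at h1
    have h2 := Int.mul_ediv_add_emod (x i) h
    have h3 := Int.emod_nonneg (x i) (show (h : ℤ) ≠ 0 by omega)
    have h4 := Int.emod_lt_of_pos (x i) (show (0 : ℤ) < h by omega)
    constructor <;> linarith
  have hmul : ∀ x ∈ E, ∀ x' ∈ E, ∀ j, j ≠ k →
      σ j * x j - σ j * x' j = σ i * x i - σ i * x' i := by
    intro x hx x' hx' j hj
    have h1 := mul_slide hσ h i x j
    have h2 := mul_slide hσ h i x' j
    rw [hE x hx x' hx' j hj, hE x hx x' hx' i hne] at h1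
    linarith
  let F : (Fin r → ℤ) → ℤ × ℤ := fun x => (x i - q, x k - q)
  have hinj : Set.InjOn F (E : Set (Fin r → ℤ)) := by
    intro x hx x' hx' hxx
    simp only [F, Prod.mk.injEq] at hxx
    have hi : x i = x' i := by linarith [hxx.1]
    funext j
    by_cases hj : j = k
    · rw [hj]; linarith [hxx.2]
    · have h1 := hmul x hx x' hx' j hj
      rw [hi] at h1
      rcases hσ j with h | h <;> rw [h] at h1 <;> linarith
  -- `x i` stays within `h` of `q` and `x k` within `4 * h` of `x i`, hence length `5 * h`; then `2
  -- * (5 * h) + 1 ≤ 11 * h`.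
  obtain ⟨d, hd, m1, m2, m3⟩ := exists_signed_chain (E.image F) (N := 5 * h) (K := K) (by
      intro p hp
      obtain ⟨x, hx, rfl⟩ := Finset.mem_image.1 hp
      have h1 := hq x hx
      have h2 := hclose x hx
      simp only [F]
      push_cast
      refine ⟨?_, ?_, ?_⟩ <;> linarith) (by
      rw [Finset.card_image_of_injOn hinj]
      refine lt_of_le_of_lt ?_ hcard
      calc K * (2 * (5 * h) + 1) ≤ K * (11 * h) := Nat.mul_le_mul_left _ (by omega)
        _ = 11 * K * h := by ring) (hσ i) (hσ k)
  have hmem : ∀ t : Fin (K + 1), ∃ x ∈ E, F x = d t := fun t => Finset.mem_image.1 (hd t)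
  choose c hc hcd using hmem
  have d1 : ∀ t, (d t).1 = c t i - q := fun t => by rw [← hcd]
  have d2 : ∀ t, (d t).2 = c t k - q := fun t => by rw [← hcd]
  have hsep : ∀ j j', j < j' → j' ≠ k → ∀ t t', c t j < c t' j' := by
    intro j j' hj hj' t t'
    have h1 := hgap _ (hc t) j j' hj hj'
    have h2 := lt_add_of_slide_eq hσ hh (hE _ (hc t') _ (hc t) j' hj')
    linarith
  have hsepk : ∀ t t', c t i < c t' k := by
    intro t t'
    have h1 := m3 t t'
    rw [d1, d2] at h1
    linarith
  refine hno ⟨c, hc, fun j t t' htt => ?_, fun j j' hj t t' => ?_⟩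
  · by_cases hj : j = k
    · have h1 := m2 htt
      simp only [d2, mul_sub] at h1
      rw [hj]
      dsimp only
      linarith
    · have h1 := hmul _ (hc t) _ (hc t') j hj
      have h2 := m1 htt
      simp only [d1, mul_sub] at h2
      dsimp only
      linarith
  · by_cases hj' : j' = k
    · subst hj'
      rcases eq_or_ne j i with rfl | hji
      · exact hsepk t t'
      · have h1 : j < i := by
          rw [Fin.lt_def] at hj ⊢
          have : (j : ℕ) ≠ i := fun h => hji (Fin.ext h)
          omega
        exact (hsep j i h1 hne t t').trans (hsepk t' t')
    · exact hsep j j' hj hj' t t'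

/-! ### Counting slid tuples at a fixed scale -/

theorem card_strictMono_le {J : Type*} [Fintype J] [LinearOrder J] (Y : Finset (J → ℤ)) {A : ℤ}
    {N : ℕ} (hY : ∀ y ∈ Y, StrictMono y ∧ ∀ j, A ≤ y j ∧ y j < A + N) :
    Y.card ≤ N.choose (Fintype.card J) := by
  have h1 : (Y.image fun y => Finset.univ.image y) ⊆
      (Finset.Ico A (A + N)).powersetCard (Fintype.card J) := by
    intro s hs
    obtain ⟨y, hy, rfl⟩ := Finset.mem_image.1 hs
    rw [Finset.mem_powersetCard]
    refine ⟨fun v hv => ?_, ?_⟩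
    · obtain ⟨j, -, rfl⟩ := Finset.mem_image.1 hv
      exact Finset.mem_Ico.2 ((hY y hy).2 j)
    · rw [Finset.card_image_of_injective _ (hY y hy).1.injective, Finset.card_univ]
  have h2 : Set.InjOn (fun y : J → ℤ => Finset.univ.image y) (Y : Set (J → ℤ)) := by
    intro y hy y' hy' h
    refine (StrictMono.range_inj (hY y hy).1 (hY y' hy').1).1 ?_
    have := congrArg (fun s : Finset ℤ => (s : Set ℤ)) h
    simpa using this
  have h3 := Finset.card_le_card h1
  rw [Finset.card_image_of_injOn h2, Finset.card_powersetCard, Int.card_Ico] at h3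
  simpa using h3

/-- The entries in `D` are encoded by `aux`, and the remaining ones form an increasing tuple, that
is, a subset of an interval. -/
theorem card_image_key_le {α : Type*} [DecidableEq α] {E : Finset (Fin r → ℤ)} (D : Finset (Fin r))
    (key : (Fin r → ℤ) → Fin r → ℤ) (A : Finset α) (aux : (Fin r → ℤ) → α) {B : ℤ} {N : ℕ}
    (haux : ∀ x ∈ E, aux x ∈ A)
    (hmono : ∀ x ∈ E, ∀ j, j ∉ D → ∀ j', j' ∉ D → j < j' → key x j < key x j')
    (hrange : ∀ x ∈ E, ∀ j, j ∉ D → B ≤ key x j ∧ key x j < B + N)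
    (hdet : ∀ x ∈ E, ∀ x' ∈ E, aux x = aux x' → (∀ j, j ∉ D → key x j = key x' j) →
      key x = key x') :
    (E.image key).card ≤ A.card * N.choose (r - D.card) := by
  let rest : (Fin r → ℤ) → {j // j ∉ D} → ℤ := fun x j => key x j
  have h1 : (E.image key).card ≤ (E.image fun x => (aux x, rest x)).card := by
    have hex : ∀ p ∈ E.image fun x => (aux x, rest x), ∃ x ∈ E, (aux x, rest x) = p := fun p hp =>
      Finset.mem_image.1 hp
    choose! g hg hg' using hex
    refine (Finset.card_le_card ?_).trans
      (Finset.card_image_le (f := fun p => key (g p)) (s := E.image fun x => (aux x, rest x)))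
    intro y hy
    obtain ⟨x, hx, rfl⟩ := Finset.mem_image.1 hy
    have hm := Finset.mem_image_of_mem (fun x => (aux x, rest x)) hx
    have he := hg' _ hm
    refine Finset.mem_image.2 ⟨_, hm, hdet _ (hg _ hm) _ hx (congrArg Prod.fst he) ?_⟩
    intro j hj
    exact congrFun (congrArg Prod.snd he) ⟨j, hj⟩
  have h2 : (E.image fun x => (aux x, rest x)) ⊆ A ×ˢ (E.image rest) := by
    intro p hp
    obtain ⟨x, hx, rfl⟩ := Finset.mem_image.1 hp
    exact Finset.mem_product.2 ⟨haux x hx, Finset.mem_image_of_mem _ hx⟩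
  have h3 : (E.image rest).card ≤ N.choose (Fintype.card {j // j ∉ D}) := by
    refine card_strictMono_le _ (A := B) ?_
    intro y hy
    obtain ⟨x, hx, rfl⟩ := Finset.mem_image.1 hy
    exact ⟨fun j j' hj => hmono x hx j j.2 j' j'.2 hj, fun j => hrange x hx j j.2⟩
  have h4 : Fintype.card {j // j ∉ D} = r - D.card := by
    rw [Fintype.card_subtype_compl, Fintype.card_fin, Fintype.card_coe]
  rw [h4] at h3
  have h5 := Finset.card_le_card h2
  rw [Finset.card_product] at h5
  exact (h1.trans h5).trans (Nat.mul_le_mul_left _ h3)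

theorem slide_eq_of_ediv_eq {σ : Fin r → ℤ} (hσ : ∀ j, σ j = 1 ∨ σ j = -1) {h : ℕ} {i : Fin r}
    {x x' : Fin r → ℤ} (hq : x i / h = x' i / h) : slide σ h i x i = slide σ h i x' i := by
  rw [slide_self hσ, slide_self hσ, hq]

theorem card_Icc_zero_natCast (a : ℕ) : (Finset.Icc (0 : ℤ) a).card = a + 1 := by
  rw [Int.card_Icc]
  omega

theorem ediv_mem_Icc {n h : ℕ} {a : ℤ} (hh : 1 ≤ h) (h0 : 0 ≤ a) (hn : a < n) :
    a / h ∈ Finset.Icc (0 : ℤ) ((n / h : ℕ) : ℤ) := by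
  rw [Finset.mem_Icc]
  refine ⟨Int.ediv_nonneg h0 (by omega), ?_⟩
  push_cast
  exact Int.ediv_le_ediv (by omega) hn.le

/-- Each entry slides by at most `h - 1`, so gaps of `2 * h - 1` keep the slid tuple increasing. Its
entry `i` is a multiple of `h`, which saves a factor `h`. -/
theorem card_le_of_gaps {σ : Fin r → ℤ} (hσ : ∀ j, σ j = 1 ∨ σ j = -1) {n h K : ℕ} (hh : 1 ≤ h)
    (i : Fin r) {E : Finset (Fin r → ℤ)} (hE : ∀ x ∈ E, ∀ j, 0 ≤ x j ∧ x j < n)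
    (hgap : ∀ x ∈ E, ∀ j j', j < j' → x j + (2 * h - 1) ≤ x j')
    (hno : ¬ HasChain σ (K + 1) E) :
    E.card ≤ K * ((n / h + 1) * (n + 2 * h).choose (r - 1)) := by
  refine (Finset.card_le_mul_card_image (f := slide σ h i) E K ?_).trans
    (Nat.mul_le_mul_left _ ?_)
  · intro y hy
    refine card_fibre_le hσ hh i ?_ ?_ fun hc => hno (hc.mono (Finset.filter_subset _ _))
    · intro x hx j j' hj
      have := hgap x (Finset.mem_filter.1 hx).1 j j' hj
      omega
    · intro x hx x' hx'
      rw [(Finset.mem_filter.1 hx).2, (Finset.mem_filter.1 hx').2]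
  · have := card_image_key_le (E := E) (D := {i}) (key := slide σ h i)
      (A := Finset.Icc (0 : ℤ) ((n / h : ℕ) : ℤ)) (aux := fun x => x i / h) (B := -h)
      (N := n + 2 * h) (fun x hx => ediv_mem_Icc hh (hE x hx i).1 (hE x hx i).2) ?_ ?_ ?_
    · rwa [card_Icc_zero_natCast, Finset.card_singleton] at this
    · intro x hx j _ j' _ hj
      have h1 := hgap x hx j j' hj
      have h2 := slide_bounds hσ hh i x j
      have h3 := slide_bounds hσ hh i x j'
      omega
    · intro x hx j _
      have h1 := hE x hx j
      have h2 := slide_bounds hσ hh i x j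
      push_cast
      omega
    · intro x hx x' hx' ha hk
      funext j
      by_cases hj : j = i
      · rw [hj]; exact slide_eq_of_ediv_eq hσ ha
      · exact hk j (by simpa using hj)

/-- `slide` with the entry `k` forgotten. -/
def slideExcept (σ : Fin r → ℤ) (h : ℕ) (i k : Fin r) (x : Fin r → ℤ) : Fin r → ℤ :=
  Function.update (slide σ h i x) k 0

theorem slideExcept_of_ne {σ : Fin r → ℤ} {h : ℕ} {i k : Fin r} {x : Fin r → ℤ} {j : Fin r}
    (hj : j ≠ k) : slideExcept σ h i k x j = slide σ h i x j :=
  Function.update_of_ne hj _ _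

theorem slideExcept_self {σ : Fin r → ℤ} {h : ℕ} {i k : Fin r} {x : Fin r → ℤ} :
    slideExcept σ h i k x k = 0 :=
  Function.update_self _ _ _

theorem card_le_mul_card_image_slideExcept {σ : Fin r → ℤ} (hσ : ∀ j, σ j = 1 ∨ σ j = -1)
    {h K : ℕ} (hh : 1 ≤ h) {i k : Fin r} (hik : (k : ℕ) = i + 1) {E : Finset (Fin r → ℤ)}
    (hgap : ∀ x ∈ E, ∀ j j', j < j' → j' ≠ k → x j + (2 * h - 1) ≤ x j')
    (hclose : ∀ x ∈ E, x i < x k ∧ x k ≤ x i + 4 * h) (hno : ¬ HasChain σ (K + 1) E) :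
    E.card ≤ 11 * K * h * (E.image (slideExcept σ h i k)).card := by
  refine Finset.card_le_mul_card_image E _ ?_
  intro y hy
  refine card_fibre_le_of_close hσ hh hik ?_ ?_ ?_
    fun hc => hno (hc.mono (Finset.filter_subset _ _))
  · intro x hx j j' hj hj'
    have := hgap x (Finset.mem_filter.1 hx).1 j j' hj hj'
    omega
  · exact fun x hx => hclose x (Finset.mem_filter.1 hx).1
  · intro x hx x' hx' j hj
    rw [← slideExcept_of_ne hj, ← slideExcept_of_ne hj, (Finset.mem_filter.1 hx).2,
      (Finset.mem_filter.1 hx').2]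

/-- The factor `h` lost in the larger fibres is regained from entry `i` being a multiple of `h`;
forgetting entry `k` lowers the binomial coefficient. -/
theorem card_le_of_one_close {σ : Fin r → ℤ} (hσ : ∀ j, σ j = 1 ∨ σ j = -1)
    {n h K : ℕ} (hh : 1 ≤ h) {i k : Fin r} (hik : (k : ℕ) = i + 1) {E : Finset (Fin r → ℤ)}
    (hE : ∀ x ∈ E, ∀ j, 0 ≤ x j ∧ x j < n)
    (hgap : ∀ x ∈ E, ∀ j j', j < j' → j' ≠ k → x j + (2 * h - 1) ≤ x j')
    (hclose : ∀ x ∈ E, x i < x k ∧ x k ≤ x i + 4 * h) (hno : ¬ HasChain σ (K + 1) E) :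
    E.card ≤ 11 * K * h * ((n / h + 1) * (n + 2 * h).choose (r - 2)) := by
  refine (card_le_mul_card_image_slideExcept hσ hh hik hgap hclose hno).trans
    (Nat.mul_le_mul_left _ ?_)
  have hne : i ≠ k := fun h => by rw [h] at hik; omega
  have := card_image_key_le (E := E) (D := {i, k}) (key := slideExcept σ h i k)
    (A := Finset.Icc (0 : ℤ) ((n / h : ℕ) : ℤ)) (aux := fun x => x i / h) (B := -h)
    (N := n + 2 * h) (fun x hx => ediv_mem_Icc hh (hE x hx i).1 (hE x hx i).2) ?_ ?_ ?_
  · rwa [card_Icc_zero_natCast, Finset.card_pair hne] at this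
  · intro x hx j hjD j' hjD' hj
    simp only [Finset.mem_insert, Finset.mem_singleton, not_or] at hjD hjD'
    rw [slideExcept_of_ne hjD.2, slideExcept_of_ne hjD'.2]
    have h1 := hgap x hx j j' hj hjD'.2
    have h2 := slide_bounds hσ hh i x j
    have h3 := slide_bounds hσ hh i x j'
    omega
  · intro x hx j hjD
    simp only [Finset.mem_insert, Finset.mem_singleton, not_or] at hjD
    rw [slideExcept_of_ne hjD.2]
    have h1 := hE x hx j
    have h2 := slide_bounds hσ hh i x j
    push_cast
    omega
  · intro x hx x' hx' ha hk
    funext j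
    by_cases hj : j = i
    · rw [hj, slideExcept_of_ne hne, slideExcept_of_ne hne]; exact slide_eq_of_ediv_eq hσ ha
    · by_cases hjk : j = k
      · rw [hjk, slideExcept_self, slideExcept_self]
      · exact hk j (by simp [hj, hjk])

/-- A second narrow gap makes entry `p` recoverable from entry `u` at the price of `O(h)` choices
instead of `O(n)`. Entry `u` must survive in the key, so it differs from `k`. -/
theorem card_le_of_two_close {σ : Fin r → ℤ} (hσ : ∀ j, σ j = 1 ∨ σ j = -1)
    {n h K : ℕ} (hh : 1 ≤ h) {i k : Fin r} (hik : (k : ℕ) = i + 1) {p u : Fin r} (hpi : p ≠ i)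
    (hpk : p ≠ k) (huk : u ≠ k) (hup : u ≠ p) {E : Finset (Fin r → ℤ)}
    (hE : ∀ x ∈ E, ∀ j, 0 ≤ x j ∧ x j < n)
    (hgap : ∀ x ∈ E, ∀ j j', j < j' → j' ≠ k → x j + (2 * h - 1) ≤ x j')
    (hclose : ∀ x ∈ E, x i < x k ∧ x k ≤ x i + 4 * h)
    (hpu : ∀ x ∈ E, x p ≤ x u + 8 * h ∧ x u ≤ x p + 8 * h)
    (hno : ¬ HasChain σ (K + 1) E) :
    E.card ≤ 11 * K * h * ((n / h + 1) * (21 * h) * (n + 2 * h).choose (r - 3)) := by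
  refine (card_le_mul_card_image_slideExcept hσ hh hik hgap hclose hno).trans
    (Nat.mul_le_mul_left _ ?_)
  have hne : i ≠ k := fun h => by rw [h] at hik; omega
  -- The distance `8 * h` grows by at most `2 * (h - 1)` under sliding, giving at most `20 * h + 1 ≤
  -- 21 * h` differences.
  have := card_image_key_le (E := E) (D := {p, i, k}) (key := slideExcept σ h i k)
    (A := Finset.Icc (0 : ℤ) ((n / h : ℕ) : ℤ) ×ˢ Finset.Icc (-(10 * h) : ℤ) (10 * h))
    (aux := fun x => (x i / h, slide σ h i x p - slide σ h i x u)) (B := -h)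
    (N := n + 2 * h) ?_ ?_ ?_ ?_
  · rw [Finset.card_eq_three.2 ⟨p, i, k, hpi, hpk, hne, rfl⟩] at this
    refine this.trans (Nat.mul_le_mul_right _ ?_)
    rw [Finset.card_product, card_Icc_zero_natCast, Int.card_Icc]
    exact Nat.mul_le_mul le_rfl (by omega)
  · intro x hx
    rw [Finset.mem_product, Finset.mem_Icc (a := (-(10 * h) : ℤ))]
    refine ⟨ediv_mem_Icc hh (hE x hx i).1 (hE x hx i).2, ?_⟩
    have h1 := hpu x hx
    have h2 := slide_bounds hσ hh i x p
    have h3 := slide_bounds hσ hh i x u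
    dsimp only
    omega
  · intro x hx j hjD j' hjD' hj
    simp only [Finset.mem_insert, Finset.mem_singleton, not_or] at hjD hjD'
    rw [slideExcept_of_ne hjD.2.2, slideExcept_of_ne hjD'.2.2]
    have h1 := hgap x hx j j' hj hjD'.2.2
    have h2 := slide_bounds hσ hh i x j
    have h3 := slide_bounds hσ hh i x j'
    omega
  · intro x hx j hjD
    simp only [Finset.mem_insert, Finset.mem_singleton, not_or] at hjD
    rw [slideExcept_of_ne hjD.2.2]
    have h1 := hE x hx j
    have h2 := slide_bounds hσ hh i x j
    push_cast
    omega
  · intro x hx x' hx' ha hk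
    rw [Prod.mk.injEq] at ha
    have hi : slide σ h i x i = slide σ h i x' i := slide_eq_of_ediv_eq hσ ha.1
    have hs : ∀ j, j ≠ k → j ≠ p → slide σ h i x j = slide σ h i x' j := by
      intro j hjk hjp
      by_cases hji : j = i
      · rw [hji, hi]
      · have := hk j (by simp [hji, hjk, hjp])
        rwa [slideExcept_of_ne hjk, slideExcept_of_ne hjk] at this
    funext j
    by_cases hjk : j = k
    · rw [hjk, slideExcept_self, slideExcept_self]
    · rw [slideExcept_of_ne hjk, slideExcept_of_ne hjk]
      by_cases hjp : j = p
      · have := hs u huk hup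
        rw [hjp]
        omega
      · exact hs j hjk hjp

/-! ### Dyadic decomposition by gaps and the general upper bound -/

/-- All consecutive gaps of `x`, except perhaps the one below the entry `k`, are at least `d`. -/
def GapsExcept (d : ℤ) (k : Fin r) (x : Fin r → ℤ) : Prop :=
  ∀ j j', j < j' → j' ≠ k → x j + d ≤ x j'

theorem add_le_of_gaps {d : ℤ} {x : Fin r → ℤ} (hx : StrictMono x) {j j' : Fin r} (hj : j < j')
    (h : ∀ l : Fin r, (j' : ℕ) = l + 1 → x l + d ≤ x j') : x j + d ≤ x j' := by
  have h1 := h ⟨j' - 1, by omega⟩ (by dsimp only; rw [Fin.lt_def] at hj; omega)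
  have h2 : x j ≤ x ⟨j' - 1, by omega⟩ := hx.monotone (by
    rw [Fin.le_def]; dsimp only; rw [Fin.lt_def] at hj; omega)
  linarith

/-- The pair `(i, k)` carries the smallest gap and `(i', k')` the second smallest. The latter fixes
the scale: every gap but the smallest is at least as large, and the smallest is narrow too. -/
theorem gaps_cases {x : Fin r → ℤ} (hx : StrictMono x) (k₀ : ℕ) :
    (∀ j j', j < j' → x j + (2 * (2 ^ k₀ : ℕ) - 1) ≤ x j') ∨
    (∃ i k : Fin r, (k : ℕ) = i + 1 ∧ GapsExcept (2 * (2 ^ k₀ : ℕ) - 1) k x ∧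
      x k ≤ x i + 4 * (2 ^ k₀ : ℕ)) ∨
    ∃ e < k₀, ∃ i k i' k' : Fin r, (k : ℕ) = i + 1 ∧ (k' : ℕ) = i' + 1 ∧ i ≠ i' ∧
      GapsExcept (2 * (2 ^ e : ℕ) - 1) k x ∧ x k ≤ x i + 4 * (2 ^ e : ℕ) ∧
      x k' ≤ x i' + 4 * (2 ^ e : ℕ) := by
  by_cases hT : ∀ j j', j < j' → x j + (2 * (2 ^ k₀ : ℕ) - 1) ≤ x j'
  · exact Or.inl hT
  right
  let I : Finset (Fin r × Fin r) := Finset.univ.filter fun p => (p.2 : ℕ) = p.1 + 1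
  have hI : ∀ p, p ∈ I ↔ (p.2 : ℕ) = p.1 + 1 := fun p => by simp [I]
  obtain ⟨q, hqI, hq⟩ : ∃ q ∈ I, x q.2 < x q.1 + (2 * (2 ^ k₀ : ℕ) - 1) := by
    by_contra! hc
    exact hT fun j j' hj => add_le_of_gaps hx hj fun l hl => hc (l, j') ((hI _).2 hl)
  obtain ⟨⟨i, k⟩, hiI, hi⟩ := Finset.exists_min_image I (fun p => x p.2 - x p.1) ⟨q, hqI⟩
  have hik := (hI _).1 hiI
  dsimp only at hik
  have hi0 := hi q hqI
  dsimp only at hi0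
  have hexc : ∀ d : ℤ, (∀ p ∈ I.erase (i, k), d ≤ x p.2 - x p.1) → GapsExcept d k x := by
    intro d hd j j' hj hj'
    refine add_le_of_gaps hx hj fun l hl => ?_
    have := hd (l, j') (Finset.mem_erase.2 ⟨by simp [hj'], (hI _).2 hl⟩)
    dsimp only at this
    linarith
  by_cases hone : ∀ p ∈ I.erase (i, k), (2 * (2 ^ k₀ : ℕ) - 1 : ℤ) ≤ x p.2 - x p.1
  · left
    exact ⟨i, k, hik, hexc _ hone, by linarith⟩
  right
  push Not at hone
  obtain ⟨q', hqI', hq'⟩ := hone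
  obtain ⟨⟨i', k'⟩, hiI', hi'⟩ :=
    Finset.exists_min_image (I.erase (i, k)) (fun p => x p.2 - x p.1) ⟨q', hqI'⟩
  have hmin := hi _ (Finset.mem_erase.1 hiI').2
  have hik' := (hI _).1 (Finset.mem_erase.1 hiI').2
  have hsmall := hi' _ hqI'
  dsimp only at hik' hsmall hmin hi'
  have hpos : x i' < x k' := hx (by rw [Fin.lt_def]; omega)
  obtain ⟨g, hg⟩ := Int.eq_ofNat_of_zero_le (show 0 ≤ x k' - x i' by linarith)
  -- `e` is determined by `2 ^ (e + 1) ≤ g + 1 < 2 ^ (e + 2)`, which gives the bounds `2 * 2 ^ e - 1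
  -- ≤ g ≤ 4 * 2 ^ e`.
  have hg1 : 2 ^ 1 ≤ g + 1 := by omega
  have hg2 : g + 1 < 2 ^ (k₀ + 1) := by rw [pow_succ]; omega
  have l1 : 1 ≤ Nat.log 2 (g + 1) := Nat.le_log_of_pow_le (by omega) hg1
  have l2 : Nat.log 2 (g + 1) < k₀ + 1 := Nat.log_lt_of_lt_pow (by omega) hg2
  obtain ⟨e, he⟩ := Nat.exists_eq_add_of_le' l1
  have b1 : 2 ^ (e + 1) ≤ g + 1 := by rw [← he]; exact Nat.pow_log_le_self 2 (by omega)
  have b2 : g + 1 < 2 ^ (e + 1 + 1) := by rw [← he]; exact Nat.lt_pow_succ_log_self (by omega) _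
  rw [pow_succ] at b1 b2
  rw [pow_succ] at b2
  refine ⟨e, by omega, i, k, i', k', hik, hik', ?_, hexc _ fun p hp => ?_, ?_, ?_⟩
  · rintro rfl
    refine (Finset.mem_erase.1 hiI').1 ?_
    rw [show k' = k from Fin.ext (by omega)]
  · have := hi' p hp
    omega
  · omega
  · omega

theorem choose_add_le_two_mul {n d k : ℕ} (hd : 2 * (d * k) + k ≤ n) :
    (n + d).choose k ≤ 2 * n.choose k := by
  cases k with
  | zero => simp
  | succ k =>
    have h1 : ∀ e ≤ d, (n + e).choose (k + 1) ≤ n.choose (k + 1) + e * (n + d).choose k := by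
      intro e
      induction e with
      | zero => simp
      | succ e ih =>
        intro he
        have h2 := ih (by omega)
        have h3 : (n + e).choose k ≤ (n + d).choose k := Nat.choose_le_choose _ (by omega)
        rw [← add_assoc, Nat.choose_succ_succ', add_mul, one_mul]
        omega
    have h2 := h1 d le_rfl
    have h3 := Nat.choose_succ_right_eq (n + d) k
    have h4 : 2 * (d * (k + 1)) ≤ n + d - k := by omega
    have h5 : (n + d).choose k * (2 * (d * (k + 1))) ≤ (n + d).choose k * (n + d - k) :=
      Nat.mul_le_mul_left _ h4
    rw [← h3] at h5
    have h6 : 2 * (d * (n + d).choose k) ≤ (n + d).choose (k + 1) := by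
      refine Nat.le_of_mul_le_mul_right (c := k + 1) ?_ (by omega)
      calc _ = (n + d).choose k * (2 * (d * (k + 1))) := by ring
        _ ≤ _ := h5
    omega

theorem mul_choose_le {n k : ℕ} (hk : k + 1 ≤ r) (hn : 2 * r ≤ n) :
    n * n.choose k ≤ 2 * r * n.choose (k + 1) := by
  have h1 := Nat.choose_succ_right_eq n k
  calc n * n.choose k ≤ 2 * (n - k) * n.choose k := Nat.mul_le_mul_right _ (by omega)
    _ = 2 * (n.choose (k + 1) * (k + 1)) := by rw [h1]; ring
    _ = 2 * (k + 1) * n.choose (k + 1) := by ring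
    _ ≤ _ := Nat.mul_le_mul_right _ (by omega)

/-- A set of increasing `r`-tuples from an interval of length `n`, without cliques of size
`K + 1`, has at most `600 r² K (n choose r - 1)` elements. -/
theorem card_le_of_not_hasChain (hr : 1 ≤ r) {σ : Fin r → ℤ} (hσ : ∀ j, σ j = 1 ∨ σ j = -1)
    {n K : ℕ} (hn : 8 * r ^ 2 ≤ n) {X : Finset (Fin r → ℤ)}
    (hX : ∀ x ∈ X, StrictMono x ∧ ∀ j, 0 ≤ x j ∧ x j < n) (hno : ¬ HasChain σ (K + 1) X) :
    X.card ≤ 600 * (r ^ 2 * K * n.choose (r - 1)) := by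
  classical
  -- The top scale `H` is of order `n / r ^ 2`: small enough that replacing `n` by `n + 2 * H` at
  -- most doubles the binomial coefficients, large enough that `n / H = O(r ^ 2)`.
  set k₀ := Nat.log 2 (n / (8 * r ^ 2))
  set H := 2 ^ k₀
  have hr2 : 0 < 8 * r ^ 2 := by positivity
  have hH1 : H ≤ n / (8 * r ^ 2) := Nat.pow_log_le_self 2 (Nat.div_pos hn hr2).ne'
  have hHn : H * (8 * r ^ 2) ≤ n := (Nat.le_div_iff_mul_le hr2).1 hH1
  have hnH : n < 2 * H * (8 * r ^ 2) := by
    have : n / (8 * r ^ 2) < 2 ^ (k₀ + 1) := Nat.lt_pow_succ_log_self (by omega) _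
    rw [pow_succ 2 k₀, mul_comm _ 2] at this
    exact (Nat.div_lt_iff_lt_mul hr2).1 this
  have hHpos : 1 ≤ H := Nat.one_le_two_pow
  have hrr : r ≤ r ^ 2 := Nat.le_self_pow (by omega) r
  have hn2 : 2 * r ≤ n := by omega
  have hHr : H * (8 * r) ≤ n := (Nat.mul_le_mul_left _ (by omega)).trans hHn
  have hchoose : ∀ h k, h ≤ H → k ≤ r → (n + 2 * h).choose k ≤ 2 * n.choose k := by
    intro h k hh hk
    apply choose_add_le_two_mul
    have : 2 * (2 * h * k) ≤ 4 * (H * r) := by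
      calc _ = 4 * (h * k) := by ring
        _ ≤ _ := Nat.mul_le_mul_left _ (Nat.mul_le_mul hh hk)
    have e : H * (8 * r) = 8 * (H * r) := by ring
    have : 1 * r ≤ H * r := Nat.mul_le_mul_right _ hHpos
    omega
  have hdiv : ∀ h, 1 ≤ h → h ≤ H → h * (n / h + 1) ≤ 2 * n := by
    intro h h1 hh
    have e1 := Nat.mul_div_le n h
    have e2 : H * 1 ≤ H * (8 * r) := Nat.mul_le_mul_left _ (by omega)
    rw [mul_add]
    omega
  let T := X.filter fun x =>
    ∀ j j' : Fin r, j < j' → x j + (2 * ((2 ^ k₀ : ℕ) : ℤ) - 1) ≤ x j'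
  let E₁ : Fin r → Finset (Fin r → ℤ) := fun i => X.filter fun x => ∃ k : Fin r,
    (k : ℕ) = i + 1 ∧ GapsExcept (2 * (2 ^ k₀ : ℕ) - 1) k x ∧ x k ≤ x i + 4 * (2 ^ k₀ : ℕ)
  let E₂ : ℕ → Fin r × Fin r → Finset (Fin r → ℤ) := fun e q => X.filter fun x =>
    ∃ k k' : Fin r, (k : ℕ) = q.1 + 1 ∧ (k' : ℕ) = q.2 + 1 ∧ q.1 ≠ q.2 ∧
      GapsExcept (2 * (2 ^ e : ℕ) - 1) k x ∧ x k ≤ x q.1 + 4 * (2 ^ e : ℕ) ∧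
      x k' ≤ x q.2 + 4 * (2 ^ e : ℕ)
  have hcover : X ⊆ T ∪ (Finset.univ.biUnion E₁ ∪
      (Finset.range k₀).biUnion fun e => Finset.univ.biUnion (E₂ e)) := by
    intro x hx
    simp only [Finset.mem_union, Finset.mem_biUnion, Finset.mem_univ, true_and, Finset.mem_range]
    rcases gaps_cases (hX x hx).1 k₀ with h | ⟨i, h⟩ | ⟨e, he, i, k, i', k', h⟩
    · exact Or.inl (Finset.mem_filter.2 ⟨hx, h⟩)
    · exact Or.inr (Or.inl ⟨i, Finset.mem_filter.2 ⟨hx, h⟩⟩)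
    · exact Or.inr (Or.inr ⟨e, he, (i, i'), Finset.mem_filter.2 ⟨hx, k, k', h⟩⟩)
  have hno' : ∀ {E}, E ⊆ X → ¬ HasChain σ (K + 1) E := fun hE hc => hno (hc.mono hE)
  set b := n.choose (r - 1)
  have hTc : T.card ≤ 32 * (r ^ 2 * K * b) := by
    have h1 := card_le_of_gaps hσ hHpos ⟨0, hr⟩ (E := T) (n := n)
      (fun x hx => (hX x (Finset.mem_filter.1 hx).1).2)
      (fun x hx => (Finset.mem_filter.1 hx).2) (hno' (Finset.filter_subset _ _))
    have h2 : n / H < 2 * (8 * r ^ 2) := (Nat.div_lt_iff_lt_mul hHpos).2 (by linarith)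
    calc _ ≤ _ := h1
      _ ≤ K * (16 * r ^ 2 * (2 * b)) := Nat.mul_le_mul_left _
          (Nat.mul_le_mul (by omega) (hchoose H _ le_rfl (by omega)))
      _ = _ := by ring
  have hE₁c : ∀ i, (E₁ i).card ≤ 88 * (r * K * b) := by
    intro i
    by_cases hi : (i : ℕ) + 1 < r
    swap
    · rw [show E₁ i = ∅ from Finset.filter_eq_empty_iff.2 (by
        rintro x - ⟨k, hk, -⟩
        omega)]
      simp
    have hmem : ∀ x ∈ E₁ i, x ∈ X ∧ GapsExcept (2 * (H : ℕ) - 1) ⟨i + 1, hi⟩ x ∧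
        x ⟨i + 1, hi⟩ ≤ x i + 4 * (H : ℕ) := by
      intro x hx
      obtain ⟨hx, k, hk, h⟩ := Finset.mem_filter.1 hx
      obtain rfl : k = ⟨i + 1, hi⟩ := Fin.ext hk
      exact ⟨hx, h⟩
    have h1 := card_le_of_one_close hσ hHpos (i := i) (k := ⟨i + 1, hi⟩) rfl (E := E₁ i) (n := n)
      (fun x hx => (hX x (hmem x hx).1).2) (fun x hx => (hmem x hx).2.1)
      (fun x hx => ⟨(hX x (hmem x hx).1).1 (by rw [Fin.lt_def]; simp), (hmem x hx).2.2⟩)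
      (hno' (Finset.filter_subset _ _))
    have h2 := mul_choose_le (n := n) (r := r) (k := r - 2) (by omega) hn2
    rw [show r - 2 + 1 = r - 1 by omega] at h2
    calc _ ≤ _ := h1
      _ = 11 * K * ((H * (n / H + 1)) * (n + 2 * H).choose (r - 2)) := by ring
      _ ≤ 11 * K * (2 * n * (2 * n.choose (r - 2))) := Nat.mul_le_mul_left _
          (Nat.mul_le_mul (hdiv H hHpos le_rfl) (hchoose H _ le_rfl (by omega)))
      _ = 44 * K * (n * n.choose (r - 2)) := by ring
      _ ≤ 44 * K * (2 * r * b) := Nat.mul_le_mul_left _ h2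
      _ = _ := by ring
  have hE₂c : ∀ e < k₀, ∀ q, (E₂ e q).card ≤ 2 ^ e * (924 * (K * (n * n.choose (r - 3)))) := by
    rintro e he ⟨i, i'⟩
    by_cases hq : (i : ℕ) + 1 < r ∧ (i' : ℕ) + 1 < r ∧ i ≠ i'
    swap
    · rw [show E₂ e (i, i') = ∅ from Finset.filter_eq_empty_iff.2 (by
        rintro x - ⟨k, k', hk, hk', hne, -⟩
        dsimp only at hk hk' hne
        exact hq ⟨by omega, by omega, hne⟩)]
      simp
    obtain ⟨hi, hi', hne⟩ := hq
    have heH : 2 ^ e ≤ H := Nat.pow_le_pow_right (by omega) he.le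
    have hmem : ∀ x ∈ E₂ e (i, i'), x ∈ X ∧ GapsExcept (2 * (2 ^ e : ℕ) - 1) ⟨i + 1, hi⟩ x ∧
        x ⟨i + 1, hi⟩ ≤ x i + 4 * (2 ^ e : ℕ) ∧ x ⟨i' + 1, hi'⟩ ≤ x i' + 4 * (2 ^ e : ℕ) := by
      intro x hx
      obtain ⟨hx, k, k', hk, hk', -, h⟩ := Finset.mem_filter.1 hx
      obtain rfl : k = ⟨i + 1, hi⟩ := Fin.ext hk
      obtain rfl : k' = ⟨i' + 1, hi'⟩ := Fin.ext hk'
      exact ⟨hx, h⟩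
    have hlt : ∀ x ∈ E₂ e (i, i'), x i < x ⟨i + 1, hi⟩ ∧ x i' < x ⟨i' + 1, hi'⟩ := fun x hx =>
      ⟨(hX x (hmem x hx).1).1 (by rw [Fin.lt_def]; simp),
        (hX x (hmem x hx).1).1 (by rw [Fin.lt_def]; simp)⟩
    have hne' : (i : ℕ) ≠ i' := fun h => hne (Fin.ext h)
    -- If the two gaps are adjacent with `i' = i + 1`, the shared entry is the forgotten one, so
    -- entries `i` and `i + 2` are compared across both gaps; hence `8` and not `4`. If `i = i' +
    -- 1`, the lower endpoint `i'` is dropped, since `i` is already encoded.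
    obtain ⟨p, u, hpi, hpk, huk, hup, hpu⟩ : ∃ p u : Fin r, p ≠ i ∧ p ≠ ⟨i + 1, hi⟩ ∧
        u ≠ ⟨i + 1, hi⟩ ∧ u ≠ p ∧ ∀ x ∈ E₂ e (i, i'), x p ≤ x u + 8 * (2 ^ e : ℕ) ∧
          x u ≤ x p + 8 * (2 ^ e : ℕ) := by
      rcases eq_or_ne (i' : ℕ) (i + 1) with h | h
      · obtain rfl : i' = ⟨i + 1, hi⟩ := Fin.ext h
        refine ⟨⟨i + 1 + 1, hi'⟩, i, Fin.ne_of_val_ne (show (i : ℕ) + 1 + 1 ≠ i by omega),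
          Fin.ne_of_val_ne (show (i : ℕ) + 1 + 1 ≠ i + 1 by omega),
          Fin.ne_of_val_ne (show (i : ℕ) ≠ i + 1 by omega),
          Fin.ne_of_val_ne (show (i : ℕ) ≠ i + 1 + 1 by omega), fun x hx => ?_⟩
        obtain ⟨-, -, h1, h2⟩ := hmem x hx
        obtain ⟨h3, h4⟩ := hlt x hx
        dsimp only at h1 h2 h3 h4
        constructor <;> linarith
      rcases eq_or_ne (i : ℕ) (i' + 1) with h' | h'
      · obtain rfl : i = ⟨i' + 1, hi'⟩ := Fin.ext h'
        refine ⟨i', ⟨i' + 1, hi'⟩, Fin.ne_of_val_ne (show (i' : ℕ) ≠ i' + 1 by omega),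
          Fin.ne_of_val_ne (show (i' : ℕ) ≠ i' + 1 + 1 by omega),
          Fin.ne_of_val_ne (show (i' : ℕ) + 1 ≠ i' + 1 + 1 by omega),
          Fin.ne_of_val_ne (show (i' : ℕ) + 1 ≠ i' by omega), fun x hx => ?_⟩
        obtain ⟨-, -, h1, h2⟩ := hmem x hx
        obtain ⟨h3, h4⟩ := hlt x hx
        constructor <;> linarith
      · refine ⟨⟨i' + 1, hi'⟩, i', Fin.ne_of_val_ne (show (i' : ℕ) + 1 ≠ i by omega),
          Fin.ne_of_val_ne (show (i' : ℕ) + 1 ≠ i + 1 by omega),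
          Fin.ne_of_val_ne (show (i' : ℕ) ≠ i + 1 by omega),
          Fin.ne_of_val_ne (show (i' : ℕ) ≠ i' + 1 by omega), fun x hx => ?_⟩
        obtain ⟨-, -, h1, h2⟩ := hmem x hx
        obtain ⟨h3, h4⟩ := hlt x hx
        constructor <;> linarith
    have h1 := card_le_of_two_close hσ (h := 2 ^ e) Nat.one_le_two_pow (i := i)
      (k := ⟨i + 1, hi⟩) rfl hpi hpk huk hup (E := E₂ e (i, i')) (n := n)
      (fun x hx => (hX x (hmem x hx).1).2) (fun x hx => (hmem x hx).2.1)
      (fun x hx => ⟨(hlt x hx).1, (hmem x hx).2.2.1⟩) hpu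
      (hno' (Finset.filter_subset _ _))
    calc _ ≤ _ := h1
      _ = 231 * 2 ^ e * K * ((2 ^ e * (n / 2 ^ e + 1)) * (n + 2 * 2 ^ e).choose (r - 3)) := by ring
      _ ≤ 231 * 2 ^ e * K * (2 * n * (2 * n.choose (r - 3))) := Nat.mul_le_mul_left _
          (Nat.mul_le_mul (hdiv _ Nat.one_le_two_pow heH) (hchoose _ _ heH (by omega)))
      _ = _ := by ring
  have hE₁t : (Finset.univ.biUnion E₁).card ≤ 88 * (r ^ 2 * K * b) := by
    calc _ ≤ ∑ i, (E₁ i).card := Finset.card_biUnion_le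
      _ ≤ ∑ _i : Fin r, 88 * (r * K * b) := Finset.sum_le_sum fun i _ => hE₁c i
      _ = _ := by
        rw [Finset.sum_const, Finset.card_univ, Fintype.card_fin, smul_eq_mul]
        ring
  have hE₂t : ((Finset.range k₀).biUnion fun e => Finset.univ.biUnion (E₂ e)).card ≤
      462 * (r ^ 2 * K * b) := by
    -- The bounds double with `e`, so the sum over scales is of the order of the top one and no
    -- logarithm appears.
    have h1 : ((Finset.range k₀).biUnion fun e => Finset.univ.biUnion (E₂ e)).card ≤
        r ^ 2 * (H * (924 * (K * (n * n.choose (r - 3))))) := by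
      calc _ ≤ ∑ e ∈ Finset.range k₀, (Finset.univ.biUnion (E₂ e)).card := Finset.card_biUnion_le
        _ ≤ ∑ e ∈ Finset.range k₀, ∑ q, (E₂ e q).card :=
          Finset.sum_le_sum fun e _ => Finset.card_biUnion_le
        _ ≤ ∑ e ∈ Finset.range k₀, ∑ _q : Fin r × Fin r,
            2 ^ e * (924 * (K * (n * n.choose (r - 3)))) :=
          Finset.sum_le_sum fun e he => Finset.sum_le_sum fun q _ =>
            hE₂c e (Finset.mem_range.1 he) q
        _ = r ^ 2 * ((∑ e ∈ Finset.range k₀, 2 ^ e) * (924 * (K * (n * n.choose (r - 3))))) := by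
          simp only [Finset.sum_const, Finset.card_univ, Fintype.card_prod, Fintype.card_fin,
            smul_eq_mul]
          rw [← Finset.mul_sum, ← Finset.sum_mul, sq]
        _ ≤ _ := by
          refine Nat.mul_le_mul_left _ (Nat.mul_le_mul_right _ ?_)
          rw [Nat.geomSum_eq le_rfl]
          simp [H]
    rcases lt_or_ge r 3 with hr3 | hr3
    · have : ((Finset.range k₀).biUnion fun e => Finset.univ.biUnion (E₂ e)) = ∅ := by
        refine Finset.eq_empty_of_forall_notMem fun x hx => ?_
        simp only [Finset.mem_biUnion] at hx
        obtain ⟨e, -, q, -, hx⟩ := hx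
        obtain ⟨-, k, k', hk, hk', hne, -⟩ := Finset.mem_filter.1 hx
        exact hne (Fin.ext (by omega))
      rw [this]
      simp
    · have h2 := mul_choose_le (n := n) (r := r) (k := r - 2) (by omega) hn2
      have h3 := mul_choose_le (n := n) (r := r) (k := r - 3) (by omega) hn2
      rw [show r - 2 + 1 = r - 1 by omega] at h2
      rw [show r - 3 + 1 = r - 2 by omega] at h3
      refine Nat.le_of_mul_le_mul_left (c := 8) ?_ (by omega)
      calc _ ≤ 8 * (r ^ 2 * (H * (924 * (K * (n * n.choose (r - 3)))))) :=
            Nat.mul_le_mul_left _ h1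
        _ = 924 * K * ((H * (8 * r ^ 2)) * (n * n.choose (r - 3))) := by ring
        _ ≤ 924 * K * (n * (2 * r * n.choose (r - 2))) :=
            Nat.mul_le_mul_left _ (Nat.mul_le_mul hHn h3)
        _ = 924 * K * (2 * r) * (n * n.choose (r - 2)) := by ring
        _ ≤ 924 * K * (2 * r) * (2 * r * b) := Nat.mul_le_mul_left _ h2
        _ = _ := by ring
  have hu1 := Finset.card_le_card hcover
  have hu2 := Finset.card_union_le T (Finset.univ.biUnion E₁ ∪
      (Finset.range k₀).biUnion fun e => Finset.univ.biUnion (E₂ e))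
  have hu3 := Finset.card_union_le (Finset.univ.biUnion E₁)
      ((Finset.range k₀).biUnion fun e => Finset.univ.biUnion (E₂ e))
  omega

/-! ### Translation between ordered graphs and chains of tuples -/

/-- The edges of `G`, as increasing tuples of integers. -/
def coords {n : ℕ} (G : OrderedGraph r n) : Finset (Fin r → ℤ) :=
  (Finset.univ.filter fun y : Fin r → Fin n => StrictMono y ∧ Finset.univ.image y ∈ G.edges).image
    fun y j => ((y j : ℕ) : ℤ)

theorem mem_coords {n : ℕ} {G : OrderedGraph r n} {x : Fin r → ℤ} : x ∈ coords G ↔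
    ∃ y : Fin r → Fin n, StrictMono y ∧ Finset.univ.image y ∈ G.edges ∧
      ∀ j, x j = ((y j : ℕ) : ℤ) := by
  simp only [coords, Finset.mem_image, Finset.mem_filter, Finset.mem_univ, true_and]
  constructor
  · rintro ⟨y, ⟨h1, h2⟩, rfl⟩
    exact ⟨y, h1, h2, fun _ => rfl⟩
  · rintro ⟨y, h1, h2, h3⟩
    exact ⟨y, ⟨h1, h2⟩, funext fun j => (h3 j).symm⟩

theorem image_univ_injective {n : ℕ} {y y' : Fin r → Fin n} (hy : StrictMono y)
    (hy' : StrictMono y') (h : Finset.univ.image y = Finset.univ.image y') : y = y' := by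
  refine (StrictMono.range_inj hy hy').1 ?_
  have := congrArg (fun s : Finset (Fin n) => (s : Set (Fin n))) h
  simpa using this

theorem exists_tuple {n : ℕ} {e : Finset (Fin n)} (he : e.card = r) :
    ∃ y : Fin r → Fin n, StrictMono y ∧ Finset.univ.image y = e := by
  refine ⟨e.orderEmbOfFin he, (e.orderEmbOfFin he).strictMono, ?_⟩
  apply Finset.coe_injective
  rw [Finset.coe_image, Finset.coe_univ, Set.image_univ, Finset.range_orderEmbOfFin]

theorem card_coords {n : ℕ} (G : OrderedGraph r n) : (coords G).card = G.edges.card := by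
  unfold coords
  rw [Finset.card_image_of_injective]
  · refine Finset.card_bij (fun y _ => Finset.univ.image y) ?_ ?_ ?_
    · exact fun y hy => (Finset.mem_filter.1 hy).2.2
    · exact fun y hy y' hy' h => image_univ_injective (Finset.mem_filter.1 hy).2.1
        (Finset.mem_filter.1 hy').2.1 h
    · intro e he
      obtain ⟨y, hy, hye⟩ := exists_tuple (G.uniform e he)
      exact ⟨y, Finset.mem_filter.2 ⟨Finset.mem_univ _, hy, hye ▸ he⟩, hye⟩
  · intro y y' h
    funext j
    have := congrFun h j
    dsimp only at this
    exact Fin.ext (by exact_mod_cast this)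

theorem strictMono_of_mem_coords {n : ℕ} {G : OrderedGraph r n} {x : Fin r → ℤ}
    (hx : x ∈ coords G) : StrictMono x ∧ ∀ j, 0 ≤ x j ∧ x j < n := by
  obtain ⟨y, hy, -, hxy⟩ := mem_coords.1 hx
  refine ⟨fun j j' hj => ?_, fun j => ?_⟩
  · rw [hxy, hxy]
    exact_mod_cast hy hj
  · rw [hxy]
    omega

/-- The signs of the pattern whose first edge is `transversal r 2 a`. -/
def patternSign (a : Fin r → Fin 2) (j : Fin r) : ℤ := if a j = 0 then 1 else -1

theorem patternSign_eq (a : Fin r → Fin 2) (j : Fin r) : patternSign a j = 1 ∨ patternSign a j = -1 := by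
  unfold patternSign
  split_ifs <;> simp

/-- The vertices of the `t`-th edge of the clique of size `m`. -/
def cliqueEdge (a : Fin r → Fin 2) {m : ℕ} (t : Fin m) (j : Fin r) : Fin m :=
  if a j = 0 then t else t.rev

theorem cliqueEdge_cliqueEdge (a : Fin r → Fin 2) {m : ℕ} (t : Fin m) (j : Fin r) :
    cliqueEdge a (cliqueEdge a t j) j = t := by
  unfold cliqueEdge
  split_ifs <;> simp

theorem patternSign_mul_cliqueEdge_lt (a : Fin r → Fin 2) {m : ℕ} {t t' : Fin m} (j : Fin r) :
    patternSign a j * ((cliqueEdge a t j : ℕ) : ℤ) < patternSign a j * ((cliqueEdge a t' j : ℕ) : ℤ) ↔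
      t < t' := by
  unfold cliqueEdge patternSign
  rw [Fin.lt_def]
  split_ifs
  · omega
  · simp only [Fin.val_rev]
    omega

/-- Sorting by the signed entry `i` suffices, because for any two tuples all signed entries compare
in the same way. -/
theorem hasChain_of_pairwise {σ : Fin r → ℤ} (i : Fin r) {X : Finset (Fin r → ℤ)}
    (hX : ∀ x ∈ X, StrictMono x)
    (hcmp : ∀ x ∈ X, ∀ x' ∈ X, x ≠ x' →
      (∀ j, σ j * x j < σ j * x' j) ∨ (∀ j, σ j * x' j < σ j * x j))
    (hsep : ∀ x ∈ X, ∀ x' ∈ X, x ≠ x' → ∀ j j', j < j' → x j < x' j') :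
    HasChain σ X.card X := by
  have hinj : Set.InjOn (fun x : Fin r → ℤ => σ i * x i) (X : Set (Fin r → ℤ)) := by
    intro x hx x' hx' h
    by_contra hne
    dsimp only at h
    rcases hcmp x hx x' hx' hne with h1 | h1 <;> linarith [h1 i]
  have hc := Finset.card_image_of_injOn hinj
  set U := X.image fun x : Fin r → ℤ => σ i * x i
  have hmem : ∀ t : Fin X.card, ∃ x ∈ X, σ i * x i = U.orderEmbOfFin hc t := fun t =>
    Finset.mem_image.1 (U.orderEmbOfFin_mem hc t)
  choose c hcX hcU using hmem
  have hlt : ∀ t t', t < t' → σ i * c t i < σ i * c t' i := by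
    intro t t' ht
    rw [hcU, hcU]
    exact (U.orderEmbOfFin hc).strictMono ht
  refine ⟨c, hcX, fun j t t' ht => ?_, fun j j' hj t t' => ?_⟩
  · have h1 := hlt t t' ht
    rcases hcmp _ (hcX t) _ (hcX t') (fun h => by rw [h] at h1; exact lt_irrefl _ h1) with h2 | h2
    · exact h2 j
    · exact absurd (h2 i) (by linarith)
  · by_cases h : c t = c t'
    · rw [h]; exact hX _ (hcX t') hj
    · exact hsep _ (hcX t) _ (hcX t') h j j' hj

theorem map_transversal {n m : ℕ} (φ : Fin (r * m) ↪o Fin n) (b : Fin r → Fin m) :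
    (transversal r m b).map φ.toEmbedding =
      Finset.univ.image fun i => φ (finProdFinEquiv (i, b i)) := by
  rw [Finset.map_eq_image]
  unfold transversal
  rw [Finset.image_image]
  rfl

theorem finProdFinEquiv_lt_of_fst_lt {m : ℕ} {i i' : Fin r} (h : i < i') (x x' : Fin m) :
    finProdFinEquiv (i, x) < finProdFinEquiv (i', x') := by
  rw [Fin.lt_def, finProdFinEquiv_apply_val, finProdFinEquiv_apply_val]
  have h2 : m * (i + 1) ≤ m * i' := Nat.mul_le_mul_left _ h
  rw [mul_add] at h2
  dsimp only
  omega

theorem finProdFinEquiv_lt_iff {m : ℕ} {i : Fin r} {x x' : Fin m} :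
    finProdFinEquiv (i, x) < finProdFinEquiv (i, x') ↔ x < x' := by
  rw [Fin.lt_def, Fin.lt_def, finProdFinEquiv_apply_val, finProdFinEquiv_apply_val]
  dsimp only
  omega

theorem exists_embedding_of_hasChain {n m : ℕ} {G : OrderedGraph r n} {a : Fin r → Fin 2}
    (h : HasChain (patternSign a) m (coords G)) :
    ∃ φ : Fin (r * m) ↪o Fin n,
      ∀ t : Fin m, (transversal r m (cliqueEdge a t)).map φ.toEmbedding ∈ G.edges := by
  obtain ⟨c, hc, hmono, hsep⟩ := h
  have hy := fun t => mem_coords.1 (hc t)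
  choose y hy1 hy2 hy3 using hy
  -- `cliqueEdge` is an involution in `t`, so it also names the edge that uses a given position of a
  -- block.
  let F : Fin (r * m) → Fin n := fun v =>
    y (cliqueEdge a (finProdFinEquiv.symm v).2 (finProdFinEquiv.symm v).1) (finProdFinEquiv.symm v).1
  have hF : ∀ i x, F (finProdFinEquiv (i, x)) = y (cliqueEdge a x i) i := by
    intro i x
    simp only [F, Equiv.symm_apply_apply]
  have hFmono : StrictMono F := by
    intro v w hvw
    obtain ⟨⟨i, x⟩, rfl⟩ := finProdFinEquiv.surjective v
    obtain ⟨⟨i', x'⟩, rfl⟩ := finProdFinEquiv.surjective w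
    rw [hF, hF]
    rcases lt_trichotomy i i' with hi | rfl | hi
    · have := hsep i i' hi (cliqueEdge a x i) (cliqueEdge a x' i')
      rw [hy3, hy3] at this
      exact_mod_cast this
    · rw [finProdFinEquiv_lt_iff] at hvw
      have hm := hmono i
      unfold cliqueEdge
      unfold patternSign at hm
      split_ifs at hm ⊢ with ha
      · have := hm hvw
        dsimp only at this
        rw [hy3, hy3] at this
        rw [Fin.lt_def]
        omega
      · have := hm (Fin.rev_lt_rev.2 hvw)
        dsimp only at this
        rw [hy3, hy3] at this
        rw [Fin.lt_def]
        omega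
    · exact absurd hvw (finProdFinEquiv_lt_of_fst_lt hi x' x).not_gt
  refine ⟨OrderEmbedding.ofStrictMono F hFmono, fun t => ?_⟩
  rw [map_transversal]
  convert hy2 t using 2
  funext i
  rw [OrderEmbedding.coe_ofStrictMono, hF, cliqueEdge_cliqueEdge]

theorem hasChain_of_embedding {n m : ℕ} {G : OrderedGraph r n} {a : Fin r → Fin 2}
    (φ : Fin (r * m) ↪o Fin n)
    (h : ∀ t : Fin m, (transversal r m (cliqueEdge a t)).map φ.toEmbedding ∈ G.edges) :
    HasChain (patternSign a) m (coords G) := by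
  refine ⟨fun t j => ((φ (finProdFinEquiv (j, cliqueEdge a t j)) : ℕ) : ℤ), fun t => ?_,
    fun j t t' ht => ?_, fun j j' hj t t' => ?_⟩
  · refine mem_coords.2 ⟨fun j => φ (finProdFinEquiv (j, cliqueEdge a t j)), ?_, ?_, fun _ => rfl⟩
    · exact fun j j' hj => φ.strictMono (finProdFinEquiv_lt_of_fst_lt hj _ _)
    · rw [← map_transversal]
      exact h t
  · have h1 := (patternSign_mul_cliqueEdge_lt a j).2 ht
    have h2 : ∀ u v : Fin m, (u : ℤ) < (v : ℤ) →
        ((φ (finProdFinEquiv (j, u)) : ℕ) : ℤ) < ((φ (finProdFinEquiv (j, v)) : ℕ) : ℤ) := by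
      intro u v huv
      have := φ.strictMono (finProdFinEquiv_lt_iff (i := j).2 (show u < v by exact_mod_cast huv))
      exact_mod_cast this
    dsimp only
    rcases patternSign_eq a j with hs | hs <;> rw [hs] at h1 ⊢
    · have := h2 (cliqueEdge a t j) (cliqueEdge a t' j) (by linarith)
      linarith
    · have := h2 (cliqueEdge a t' j) (cliqueEdge a t j) (by linarith)
      linarith
  · have := φ.strictMono (finProdFinEquiv_lt_of_fst_lt hj (cliqueEdge a t j) (cliqueEdge a t' j'))
    dsimp only
    exact_mod_cast this

theorem cmp_of_formsPattern {n : ℕ} {P : OrderedGraph r (r * 2)} {a : Fin r → Fin 2}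
    (ha : P.edges = {transversal r 2 a, transversal r 2 fun i => (a i).rev})
    {y z : Fin r → Fin n} (hy : StrictMono y) (hz : StrictMono z)
    (h : FormsPattern P (Finset.univ.image y) (Finset.univ.image z)) :
    ((∀ j, patternSign a j * ((y j : ℕ) : ℤ) < patternSign a j * ((z j : ℕ) : ℤ)) ∨
      (∀ j, patternSign a j * ((z j : ℕ) : ℤ) < patternSign a j * ((y j : ℕ) : ℤ))) ∧
      ∀ j j', j < j' → y j < z j' := by
  obtain ⟨φ, -, h⟩ := h
  rw [ha, Finset.image_insert, Finset.image_singleton, map_transversal, map_transversal] at h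
  have hmono : ∀ b : Fin r → Fin 2, StrictMono fun i => φ (finProdFinEquiv (i, b i)) := fun b j j' hj =>
    φ.strictMono (finProdFinEquiv_lt_of_fst_lt hj _ _)
  have hcmp : ∀ j, patternSign a j * ((φ (finProdFinEquiv (j, a j)) : ℕ) : ℤ) <
      patternSign a j * ((φ (finProdFinEquiv (j, (a j).rev)) : ℕ) : ℤ) := by
    intro j
    unfold patternSign
    split_ifs with hj
    · have := φ.strictMono (finProdFinEquiv_lt_iff (i := j).2
        (show a j < (a j).rev by rw [hj]; decide))
      rw [Fin.lt_def] at this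
      omega
    · have := φ.strictMono (finProdFinEquiv_lt_iff (i := j).2
        (show (a j).rev < a j by rw [show a j = 1 by omega]; decide))
      rw [Fin.lt_def] at this
      omega
  have hset := congrArg (fun s : Finset (Finset (Fin n)) => (s : Set (Finset (Fin n)))) h
  simp only [Finset.coe_insert, Finset.coe_singleton] at hset
  rcases Set.pair_eq_pair_iff.1 hset with ⟨h1, h2⟩ | ⟨h1, h2⟩
  · obtain rfl := image_univ_injective (hmono _) hy h1
    obtain rfl := image_univ_injective (hmono _) hz h2
    exact ⟨Or.inl hcmp, fun j j' hj => φ.strictMono (finProdFinEquiv_lt_of_fst_lt hj _ _)⟩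
  · obtain rfl := image_univ_injective (hmono _) hz h1
    obtain rfl := image_univ_injective (hmono _) hy h2
    exact ⟨Or.inr hcmp, fun j j' hj => φ.strictMono (finProdFinEquiv_lt_of_fst_lt hj _ _)⟩

/-- Cliques of a partite pattern are unique. -/
theorem IsClique.edges_eq {m : ℕ} (hr : 1 ≤ r) {P : OrderedGraph r (r * 2)} {a : Fin r → Fin 2}
    (ha : P.edges = {transversal r 2 a, transversal r 2 fun i => (a i).rev})
    {Q : OrderedGraph r (r * m)} (hQ : IsClique P m Q) :
    Q.edges = Finset.univ.image fun t : Fin m => transversal r m (cliqueEdge a t) := by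
  have key : ∀ x ∈ coords Q, ∀ x' ∈ coords Q, x ≠ x' →
      ((∀ j, patternSign a j * x j < patternSign a j * x' j) ∨
        (∀ j, patternSign a j * x' j < patternSign a j * x j)) ∧ ∀ j j', j < j' → x j < x' j' := by
    intro x hx x' hx' hne
    obtain ⟨y, hy, hye, hxy⟩ := mem_coords.1 hx
    obtain ⟨z, hz, hze, hxz⟩ := mem_coords.1 hx'
    have := cmp_of_formsPattern ha hy hz (hQ.2.2 _ hye _ hze fun h => hne (by
      funext j
      rw [hxy, hxz, image_univ_injective hy hz h]))
    simp only [hxy, hxz]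
    exact_mod_cast this
  have hch : HasChain (patternSign a) m (coords Q) := by
    have := hasChain_of_pairwise (σ := patternSign a) ⟨0, hr⟩ (X := coords Q)
      (fun x hx => (strictMono_of_mem_coords hx).1) (fun x hx x' hx' hne => (key x hx x' hx' hne).1)
      (fun x hx x' hx' hne => (key x hx x' hx' hne).2)
    rwa [card_coords, hQ.2.1] at this
  obtain ⟨φ, hφ⟩ := exists_embedding_of_hasChain hch
  -- `Q` has exactly `r * m` vertices, so the order embedding is the identity and the standard
  -- clique lies inside `Q`.
  have hid : φ.toEmbedding = Function.Embedding.refl _ := by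
    ext v
    have : (φ : Fin (r * m) → Fin (r * m)) = id := by
      refine (StrictMono.range_inj φ.strictMono strictMono_id).1 ?_
      rw [(Finite.injective_iff_surjective.1 φ.injective).range_eq, Set.range_id]
    simpa using congrArg Fin.val (congrFun this v)
  symm
  refine Finset.eq_of_subset_of_card_le ?_ ?_
  · intro e he
    obtain ⟨t, -, rfl⟩ := Finset.mem_image.1 he
    have := hφ t
    rwa [hid, Finset.map_refl] at this
  · rw [hQ.2.1, Finset.card_image_of_injective, Finset.card_univ, Fintype.card_fin]
    intro t t' h
    have := congrFun (transversal_inj h) ⟨0, hr⟩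
    rw [← cliqueEdge_cliqueEdge a t ⟨0, hr⟩, this, cliqueEdge_cliqueEdge]

theorem contains_iff_hasChain {n m : ℕ} (hr : 1 ≤ r) {P : OrderedGraph r (r * 2)}
    {a : Fin r → Fin 2} (ha : P.edges = {transversal r 2 a, transversal r 2 fun i => (a i).rev})
    {Q : OrderedGraph r (r * m)} (hQ : IsClique P m Q) (G : OrderedGraph r n) :
    G.Contains Q ↔ HasChain (patternSign a) m (coords G) := by
  constructor
  · rintro ⟨φ, hφ⟩
    refine hasChain_of_embedding φ fun t => hφ _ ?_
    rw [hQ.edges_eq hr ha]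
    exact Finset.mem_image_of_mem _ (Finset.mem_univ t)
  · intro h
    obtain ⟨φ, hφ⟩ := exists_embedding_of_hasChain h
    refine ⟨φ, fun e he => ?_⟩
    rw [hQ.edges_eq hr ha] at he
    obtain ⟨t, -, rfl⟩ := Finset.mem_image.1 he
    exact hφ t

/-! ### The lower bound by forbidding last edges -/

/-- The complete ordered `r`-graph. -/
def completeOrdered (r n : ℕ) : OrderedGraph r n where
  edges := Finset.univ.powersetCard r
  uniform := fun _ he => (Finset.mem_powersetCard.1 he).2

theorem card_coords_completeOrdered (r n : ℕ) : (coords (completeOrdered r n)).card = n.choose r := by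
  rw [card_coords, completeOrdered, Finset.card_powersetCard, Finset.card_univ, Fintype.card_fin]

theorem mem_coords_completeOrdered {n : ℕ} {x : Fin r → ℤ} :
    x ∈ coords (completeOrdered r n) ↔ StrictMono x ∧ ∀ j, 0 ≤ x j ∧ x j < n := by
  refine ⟨strictMono_of_mem_coords, fun ⟨h1, h2⟩ => ?_⟩
  have h3 : ∀ j, (x j).toNat < n := fun j => by have := h2 j; omega
  have hy : StrictMono fun j => (⟨(x j).toNat, h3 j⟩ : Fin n) := fun j j' hj => by
    have h4 := h1 hj
    have h5 := h2 j
    rw [Fin.mk_lt_mk]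
    omega
  refine mem_coords.2 ⟨_, hy, ?_, fun j => ?_⟩
  · refine Finset.mem_powersetCard.2 ⟨Finset.subset_univ _, ?_⟩
    rw [Finset.card_image_of_injective _ hy.injective, Finset.card_univ, Fintype.card_fin]
  · have := h2 j
    dsimp only
    omega

theorem strictMono_of_lt_next {z : Fin r → ℤ} (h : ∀ j j' : Fin r, (j' : ℕ) = j + 1 → z j < z j') :
    StrictMono z := by
  cases r with
  | zero => exact fun j => j.elim0
  | succ r => exact Fin.strictMono_iff_lt_succ.2 fun i => h _ _ (by simp)

theorem add_le_of_strictMono {K : ℕ} {f : Fin (K + 1) → ℤ} (hf : StrictMono f) :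
    f 0 + K ≤ f (Fin.last K) := by
  have h : ∀ t : Fin (K + 1), f 0 + (t : ℕ) ≤ f t := by
    intro t
    induction t using Fin.induction with
    | zero => simp
    | succ t ih =>
      have := hf t.castSucc_lt_succ
      rw [Fin.val_castSucc] at ih
      rw [Fin.val_succ]
      omega
  simpa using h (Fin.last K)

/-- The number of forced vertices, in units of `m - 1`, below the entry `j` of the last edge of a
clique of size `m`. -/
def lastOffset (σ : Fin r → ℤ) (j : Fin r) : ℤ := j + if σ j = 1 then 1 else 0

/-- The tuples that can be the last edge of a clique of size `K + 1`. -/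
noncomputable def lastEdges (σ : Fin r → ℤ) (n K : ℕ) : Finset (Fin r → ℤ) :=
  (coords (completeOrdered r n)).filter fun x =>
    StrictMono (fun j => x j - K * lastOffset σ j) ∧
      ∀ j, 0 ≤ x j - K * lastOffset σ j ∧ x j - K * lastOffset σ j < n - r * K

theorem card_lastEdges_le (hr : 1 ≤ r) (σ : Fin r → ℤ) (n K : ℕ) :
    (lastEdges σ n K).card ≤ (n - r * K).choose r := by
  have hinj : Function.Injective fun (x : Fin r → ℤ) j => x j - K * lastOffset σ j := by
    intro x x' h
    funext j
    have := congrFun h j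
    dsimp only at this
    linarith
  rw [← Finset.card_image_of_injective _ hinj]
  have := card_strictMono_le ((lastEdges σ n K).image fun x j => x j - K * lastOffset σ j) (A := 0)
    (N := n - r * K) (by
      intro z hz
      obtain ⟨x, hx, rfl⟩ := Finset.mem_image.1 hz
      obtain ⟨-, h1, h2⟩ := Finset.mem_filter.1 hx
      refine ⟨h1, fun j => ⟨(h2 j).1, ?_⟩⟩
      have h3 : (((r * K : ℕ) : ℤ)) ≤ n := by
        push_cast
        linarith [(h2 ⟨0, hr⟩).1, (h2 ⟨0, hr⟩).2]
      rw [Nat.cast_sub (by exact_mod_cast h3)]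
      push_cast
      linarith [(h2 j).2])
  rwa [Fintype.card_fin] at this

/-- Beside entry `j` of the last edge the first edge sits at distance at least `K`: below if `σ j =
1`, above otherwise. As blocks are disjoint, compressing out these `r * K` positions keeps the
entries increasing and within `[0, n - r * K)`. -/
theorem last_mem_lastEdges {σ : Fin r → ℤ} (hσ : ∀ j, σ j = 1 ∨ σ j = -1) {n K : ℕ}
    {c : Fin (K + 1) → Fin r → ℤ} (hc : ∀ t, c t ∈ coords (completeOrdered r n))
    (hmono : ∀ j, StrictMono fun t => σ j * c t j)
    (hsep : ∀ j j', j < j' → ∀ t t', c t j < c t' j') : c (Fin.last K) ∈ lastEdges σ n K := by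
  have hstep : ∀ j, σ j * c 0 j + K ≤ σ j * c (Fin.last K) j := fun j =>
    add_le_of_strictMono (hmono j)
  set y := c (Fin.last K) with hy
  have hbot : ∀ j, ∃ t, c t j ≤ y j - K * (if σ j = 1 then 1 else 0) := by
    intro j
    have := hstep j
    rcases hσ j with h | h
    · refine ⟨0, ?_⟩
      rw [h] at this
      rw [if_pos h]
      linarith
    · exact ⟨Fin.last K, by simp [h, hy]⟩
  have htop : ∀ j, ∃ t, y j + K * (1 - if σ j = 1 then 1 else 0) ≤ c t j := by
    intro j
    have := hstep j
    rcases hσ j with h | h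
    · exact ⟨Fin.last K, by simp [h, hy]⟩
    · refine ⟨0, ?_⟩
      rw [h] at this
      rw [if_neg (by omega)]
      linarith
  have hz : StrictMono fun j => y j - K * lastOffset σ j := by
    refine strictMono_of_lt_next fun j j' hj => ?_
    obtain ⟨t, ht⟩ := htop j
    obtain ⟨t', ht'⟩ := hbot j'
    have := hsep j j' (by rw [Fin.lt_def]; omega) t t'
    have hj' : ((j' : ℕ) : ℤ) = j + 1 := by exact_mod_cast hj
    simp only [lastOffset, hj']
    linarith
  refine Finset.mem_filter.2 ⟨hc _, hz, fun j => ⟨?_, ?_⟩⟩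
  · have hr : 0 < r := j.pos
    have h1 : (fun j => y j - K * lastOffset σ j) ⟨0, hr⟩ ≤ (fun j => y j - K * lastOffset σ j) j :=
      hz.monotone (by rw [Fin.le_def]; exact Nat.zero_le _)
    obtain ⟨t, ht⟩ := hbot ⟨0, hr⟩
    have h2 := ((mem_coords_completeOrdered.1 (hc t)).2 ⟨0, hr⟩).1
    simp only [lastOffset, Nat.cast_zero] at h1
    simp only [lastOffset]
    linarith
  · have hr : r - 1 < r := by have := j.pos; omega
    have h1 : (fun j => y j - K * lastOffset σ j) j ≤
        (fun j => y j - K * lastOffset σ j) ⟨r - 1, hr⟩ :=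
      hz.monotone (by rw [Fin.le_def]; dsimp only; omega)
    obtain ⟨t, ht⟩ := htop ⟨r - 1, hr⟩
    have h2 := ((mem_coords_completeOrdered.1 (hc t)).2 ⟨r - 1, hr⟩).2
    have h3 : ((r - 1 : ℕ) : ℤ) = r - 1 := by omega
    simp only [lastOffset, h3] at h1
    simp only [lastOffset]
    linarith

theorem exists_free_graph (hr : 1 ≤ r) {σ : Fin r → ℤ} (hσ : ∀ j, σ j = 1 ∨ σ j = -1) (n K : ℕ) :
    ∃ G : OrderedGraph r n, ¬ HasChain σ (K + 1) (coords G) ∧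
      n.choose r - (n - r * K).choose r ≤ G.edges.card := by
  classical
  let bad : Finset (Fin n) → Prop := fun e => ∃ y : Fin r → Fin n, StrictMono y ∧
    Finset.univ.image y = e ∧ (fun j => ((y j : ℕ) : ℤ)) ∈ lastEdges σ n K
  let G : OrderedGraph r n :=
    { edges := (completeOrdered r n).edges.filter fun e => ¬ bad e
      uniform := fun e he => (completeOrdered r n).uniform e (Finset.mem_filter.1 he).1 }
  let B : OrderedGraph r n :=
    { edges := (completeOrdered r n).edges.filter bad
      uniform := fun e he => (completeOrdered r n).uniform e (Finset.mem_filter.1 he).1 }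
  refine ⟨G, ?_, ?_⟩
  · rintro ⟨c, hc, hmono, hsep⟩
    have hlast := last_mem_lastEdges hσ (fun t =>
      mem_coords_completeOrdered.2 (strictMono_of_mem_coords (hc t))) hmono hsep
    obtain ⟨y, hy, hye, hxy⟩ := mem_coords.1 (hc (Fin.last K))
    exact (Finset.mem_filter.1 hye).2 ⟨y, hy, rfl, by rwa [← funext hxy]⟩
  · have h1 : (coords B).card ≤ (lastEdges σ n K).card := by
      refine Finset.card_le_card fun x hx => ?_
      obtain ⟨y, hy, hye, hxy⟩ := mem_coords.1 hx
      obtain ⟨y', hy', he, hm⟩ := (Finset.mem_filter.1 hye).2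
      obtain rfl := image_univ_injective hy' hy he
      rwa [← funext hxy] at hm
    have h2 := card_lastEdges_le hr σ n K
    have h3 : B.edges.card + G.edges.card = (completeOrdered r n).edges.card :=
      Finset.card_filter_add_card_filter_not _
    rw [← card_coords (completeOrdered r n), card_coords_completeOrdered] at h3
    rw [card_coords] at h1
    omega

/-! ### The exact value for the alternating pattern -/

/-- The signs of the alternating pattern. -/
def alternatingSign (r : ℕ) (j : Fin r) : ℤ := if Even (j : ℕ) then 1 else -1

theorem alternatingSign_eq (j : Fin r) : alternatingSign r j = 1 ∨ alternatingSign r j = -1 := by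
  unfold alternatingSign
  split_ifs <;> simp

/-- Tuples that differ by a multiple of the alternating direction form the alternating pattern. -/
theorem alternating_sep {x : Fin r → ℤ} {u : ℤ} (hu : 0 ≤ u) (hx : StrictMono x)
    (hx' : StrictMono fun j => x j + u * alternatingSign r j) {j j' : Fin r} (hj : j < j') :
    x j < x j' + u * alternatingSign r j' ∧ x j + u * alternatingSign r j < x j' := by
  -- Entries `j` and `j + 1` approach or part from each other, so the tuple in which they are closer
  -- separates them for both; monotonicity then reaches `j'`.
  obtain ⟨l, hl⟩ : ∃ l : Fin r, (l : ℕ) = j + 1 := ⟨⟨j + 1, by omega⟩, rfl⟩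
  have hjl : j < l := by rw [Fin.lt_def]; omega
  have hlj : l ≤ j' := by rw [Fin.le_def]; omega
  have h1 := hx hjl
  have h2 := hx' hjl
  have h3 := hx.monotone hlj
  have h4 := hx'.monotone hlj
  have h5 : alternatingSign r l = - alternatingSign r j := by
    unfold alternatingSign
    simp only [hl, Nat.even_add_one]
    split_ifs <;> simp_all
  dsimp only at h2 h4
  rw [h5] at h2 h4
  rcases alternatingSign_eq j with h | h <;> rw [h] at h2 h4 ⊢ <;> constructor <;> linarith

theorem choose_le_card_starts (r n K : ℕ) :
    (n - r * K).choose r ≤ ((coords (completeOrdered r n)).filter fun x =>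
      (fun j => x j + K * alternatingSign r j) ∈ coords (completeOrdered r n)).card := by
  rw [← card_coords_completeOrdered]
  -- The offsets are `0, 2, 2, 4, 4, …`, and after one step along the line `1, 1, 3, 3, …`. Both
  -- sequences are weakly increasing and at most `r`, so both ends of the segment stay increasing
  -- inside `[0, n)`.
  let off : Fin r → ℤ := fun j => if Even (j : ℕ) then (j : ℤ) else j + 1
  have hoff : ∀ j, 0 ≤ off j ∧ off j ≤ r ∧ 0 ≤ off j + alternatingSign r j ∧
      off j + alternatingSign r j ≤ r := by
    intro j
    simp only [off, alternatingSign]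
    split_ifs <;> omega
  have hmono : ∀ j j' : Fin r, j < j' → off j ≤ off j' ∧
      off j + alternatingSign r j ≤ off j' + alternatingSign r j' := by
    intro j j' hj
    rw [Fin.lt_def] at hj
    simp only [off, alternatingSign, Nat.even_iff]
    split_ifs <;> omega
  have hinj : Function.Injective fun (z : Fin r → ℤ) j => z j + K * off j := by
    intro x x' h
    funext j
    have := congrFun h j
    dsimp only at this
    linarith
  rw [← Finset.card_image_of_injective _ hinj]
  have hmem : ∀ (z : Fin r → ℤ) (o : Fin r → ℤ), z ∈ coords (completeOrdered r (n - r * K)) →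
      (∀ j, 0 ≤ o j ∧ o j ≤ r) → (∀ j j', j < j' → o j ≤ o j') →
      (fun j => z j + K * o j) ∈ coords (completeOrdered r n) := by
    intro z o hz ho ho'
    obtain ⟨h1, h2⟩ := mem_coords_completeOrdered.1 hz
    refine mem_coords_completeOrdered.2 ⟨fun j j' hj => ?_, fun j => ?_⟩
    · have := mul_le_mul_of_nonneg_left (ho' j j' hj) (Int.natCast_nonneg K)
      have := h1 hj
      dsimp only
      linarith
    · have h3 := mul_nonneg (Int.natCast_nonneg K) (ho j).1
      have h4 := mul_le_mul_of_nonneg_left (ho j).2 (Int.natCast_nonneg K)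
      have h5 := h2 j
      have h6 : ((r * K : ℕ) : ℤ) = K * r := by push_cast; ring
      omega
  refine Finset.card_le_card fun x hx => ?_
  obtain ⟨z, hz, rfl⟩ := Finset.mem_image.1 hx
  refine Finset.mem_filter.2 ⟨hmem z off hz (fun j => ⟨(hoff j).1, (hoff j).2.1⟩)
    fun j j' hj => (hmono j j' hj).1, ?_⟩
  have := hmem z (fun j => off j + alternatingSign r j) hz
    (fun j => ⟨(hoff j).2.2.1, (hoff j).2.2.2⟩) fun j j' hj => (hmono j j' hj).2
  convert this using 2
  ring

/-- A chain-free subset of a line has at most `K` points, while a line containing a start (a point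
whose `K`-th translate is still valid) has at least `K` points that are not starts. -/
theorem card_line_le (hr : 1 ≤ r) {n K : ℕ} {X : Finset (Fin r → ℤ)}
    {A : Finset (Fin r → ℤ)} (hA : A ⊆ coords (completeOrdered r n)) (hXA : X ⊆ A)
    (hconv : ∀ x ∈ A, ∀ u : ℤ, (fun j => x j + u * alternatingSign r j) ∈
      coords (completeOrdered r n) → (fun j => x j + u * alternatingSign r j) ∈ A)
    (hline : ∀ x ∈ A, ∀ x' ∈ A, ∃ u : ℤ, ∀ j, x' j = x j + u * alternatingSign r j)
    (hno : ¬ HasChain (alternatingSign r) (K + 1) X) :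
    X.card + (A.filter fun x =>
      (fun j => x j + K * alternatingSign r j) ∈ coords (completeOrdered r n)).card ≤ A.card := by
  set S := A.filter fun x =>
    (fun j => x j + K * alternatingSign r j) ∈ coords (completeOrdered r n)
  have hSA : S ⊆ A := Finset.filter_subset _ _
  rcases S.eq_empty_or_nonempty with hS | hS
  · rw [hS, Finset.card_empty, add_zero]
    exact Finset.card_le_card hXA
  let i : Fin r := ⟨0, hr⟩
  have hi : alternatingSign r i = 1 := by simp [alternatingSign, i]
  obtain ⟨s, hs, hmax⟩ := Finset.exists_max_image S (fun x => x i) hS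
  obtain ⟨hsA, hsK⟩ := Finset.mem_filter.1 hs
  have hXK : X.card ≤ K := by
    by_contra! hlt
    obtain ⟨Y, hY, hYc⟩ := Finset.exists_subset_card_eq (show K + 1 ≤ X.card from hlt)
    refine hno (HasChain.mono ?_ hY)
    rw [← hYc]
    have hYm : ∀ x ∈ Y, StrictMono x := fun x hx => (strictMono_of_mem_coords (hA (hXA (hY hx)))).1
    have hYl : ∀ x ∈ Y, ∀ x' ∈ Y, ∃ u : ℤ, x' = fun j => x j + u * alternatingSign r j := by
      intro x hx x' hx'
      obtain ⟨u, hu⟩ := hline x (hXA (hY hx)) x' (hXA (hY hx'))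
      exact ⟨u, funext hu⟩
    have hsq : ∀ j, alternatingSign r j * alternatingSign r j = 1 := fun j => by
      rcases alternatingSign_eq j with h | h <;> simp [h]
    have hmul : ∀ j (a u : ℤ), alternatingSign r j * (a + u * alternatingSign r j) =
        alternatingSign r j * a + u := fun j a u => by
      linear_combination u * hsq j
    refine hasChain_of_pairwise i hYm ?_ ?_
    · intro x hx x' hx' hne
      obtain ⟨u, rfl⟩ := hYl x hx x' hx'
      rcases lt_trichotomy u 0 with hu | rfl | hu
      · right
        intro j
        rw [hmul]
        linarith
      · simp at hne
      · left
        intro j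
        rw [hmul]
        linarith
    · intro x hx x' hx' _ j j' hj
      obtain ⟨u, rfl⟩ := hYl x hx x' hx'
      rcases le_total 0 u with hu | hu
      · exact (alternating_sep hu (hYm _ hx) (hYm _ hx') hj).1
      · have hx2 : StrictMono fun j => (x j + u * alternatingSign r j) +
            -u * alternatingSign r j := by
          convert hYm _ hx using 2
          ring
        have := (alternating_sep (u := -u) (by omega) (hYm _ hx') hx2 hj).2
        linarith
  -- The `K` points following the last start `s` are valid, since validity is convex along the line,
  -- and are not starts by maximality.
  have hsub : ((Finset.Icc (1 : ℤ) K).image fun u j => s j + u * alternatingSign r j) ⊆ A \ S := by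
    intro x hx
    obtain ⟨u, hu, rfl⟩ := Finset.mem_image.1 hx
    rw [Finset.mem_Icc] at hu
    obtain ⟨h1, h2⟩ := strictMono_of_mem_coords (hA hsA)
    obtain ⟨h3, h4⟩ := strictMono_of_mem_coords hsK
    refine Finset.mem_sdiff.2 ⟨hconv s hsA u (mem_coords_completeOrdered.2
      ⟨fun j j' hj => ?_, fun j => ?_⟩), fun hxS => ?_⟩
    · have h5 := h1 hj
      have h6 := h3 hj
      dsimp only at h6 ⊢
      rcases alternatingSign_eq j with h | h <;> rcases alternatingSign_eq j' with h' | h' <;>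
        rw [h, h'] at h6 ⊢ <;> linarith
    · have h5 := h2 j
      have h6 := h4 j
      rcases alternatingSign_eq j with h | h <;> rw [h] at h6 ⊢ <;> constructor <;> linarith
    · have := hmax _ hxS
      rw [hi] at this
      linarith
  have hcard : ((Finset.Icc (1 : ℤ) K).image fun u j => s j + u * alternatingSign r j).card = K := by
    rw [Finset.card_image_of_injective, Int.card_Icc]
    · omega
    · intro u u' h
      have := congrFun h i
      simp only [hi] at this
      linarith
  have h1 := Finset.card_le_card hsub
  rw [hcard, Finset.card_sdiff_of_subset hSA] at h1
  have h2 := Finset.card_le_card hSA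
  omega

theorem card_le_of_not_hasChain_alternating (hr : 1 ≤ r) {n K : ℕ} {X : Finset (Fin r → ℤ)}
    (hX : X ⊆ coords (completeOrdered r n)) (hno : ¬ HasChain (alternatingSign r) (K + 1) X) :
    X.card ≤ n.choose r - (n - r * K).choose r := by
  classical
  set A := coords (completeOrdered r n) with hA
  let i : Fin r := ⟨0, hr⟩
  have hi : alternatingSign r i = 1 := by simp [alternatingSign, i]
  -- `key` moves each tuple along its line until entry `i` is zero, so its fibres are the lines.
  let key : (Fin r → ℤ) → Fin r → ℤ := fun x j => x j - alternatingSign r j * x i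
  have hkey : ∀ x u, key (fun j => x j + u * alternatingSign r j) = key x := by
    intro x u
    funext j
    simp only [key, hi]
    ring
  set S := A.filter fun x => (fun j => x j + K * alternatingSign r j) ∈ A
  have hSA : S ⊆ A := Finset.filter_subset _ _
  have hmaps : ∀ {Y}, Y ⊆ A → ∀ x ∈ Y, key x ∈ A.image key := fun hY x hx =>
    Finset.mem_image_of_mem _ (hY hx)
  have hsum : X.card + S.card ≤ A.card := by
    rw [Finset.card_eq_sum_card_fiberwise (hmaps hX), Finset.card_eq_sum_card_fiberwise (hmaps hSA),
      Finset.card_eq_sum_card_fiberwise (hmaps (Finset.Subset.refl A)), ← Finset.sum_add_distrib]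
    refine Finset.sum_le_sum fun f _ => ?_
    have := card_line_le hr (X := X.filter fun x => key x = f) (A := A.filter fun x => key x = f)
      (K := K) (n := n) (Finset.filter_subset _ _) (Finset.filter_subset_filter _ hX) ?_ ?_
      fun hc => hno (hc.mono (Finset.filter_subset _ _))
    · rwa [Finset.filter_comm] at this
    · intro x hx u hu
      exact Finset.mem_filter.2 ⟨hu, (hkey x u).trans (Finset.mem_filter.1 hx).2⟩
    · intro x hx x' hx'
      refine ⟨x' i - x i, fun j => ?_⟩
      have := congrFun ((Finset.mem_filter.1 hx).2.trans (Finset.mem_filter.1 hx').2.symm) j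
      simp only [key] at this
      linarith
  have h1 : (n - r * K).choose r ≤ S.card := choose_le_card_starts r n K
  rw [hA, card_coords_completeOrdered] at hsum
  omega

/-! ### Assembling the three statements -/

theorem alternatingPattern_edges (r : ℕ) : ∃ a : Fin r → Fin 2,
    (alternatingPattern r).edges = {transversal r 2 a, transversal r 2 fun i => (a i).rev} ∧
      patternSign a = alternatingSign r := by
  refine ⟨fun i => if Even (i : ℕ) then 0 else 1, ?_, ?_⟩
  · have : (fun i : Fin r => (if Even (i : ℕ) then (0 : Fin 2) else 1).rev) =
        fun i : Fin r => if Even (i : ℕ) then 1 else 0 := by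
      funext i
      split_ifs <;> rfl
    rw [this]
    rfl
  · funext j
    simp only [patternSign, alternatingSign]
    split_ifs <;> simp_all

theorem exOrd_spec {n m : ℕ} (hr : 1 ≤ r) (hm : 1 ≤ m) {P : OrderedGraph r (r * 2)}
    {a : Fin r → Fin 2} (ha : P.edges = {transversal r 2 a, transversal r 2 fun i => (a i).rev})
    {Q : OrderedGraph r (r * m)} (hQ : IsClique P m Q) :
    (∀ G : OrderedGraph r n, ¬ HasChain (patternSign a) m (coords G) →
      G.edges.card ≤ exOrd n Q) ∧
    ∃ X ⊆ coords (completeOrdered r n), ¬ HasChain (patternSign a) m X ∧ X.card = exOrd n Q := by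
  have hne : Q.edges.Nonempty := Finset.card_pos.1 (by rw [hQ.2.1]; omega)
  obtain ⟨⟨G, hG, hGc⟩, hub⟩ := exOrd_isGreatest n Q hne
  refine ⟨fun G hG => hub ⟨G, fun h => hG ((contains_iff_hasChain hr ha hQ G).1 h), rfl⟩,
    coords G, fun x hx => mem_coords_completeOrdered.2 (strictMono_of_mem_coords hx),
    fun h => hG ((contains_iff_hasChain hr ha hQ G).2 h), ?_⟩
  rw [card_coords, hGc]

theorem le_exOrd {n m : ℕ} (hr : 1 ≤ r) (hm : 1 ≤ m) {P : OrderedGraph r (r * 2)}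
    {a : Fin r → Fin 2} (ha : P.edges = {transversal r 2 a, transversal r 2 fun i => (a i).rev})
    {Q : OrderedGraph r (r * m)} (hQ : IsClique P m Q) :
    n.choose r - (n - r * (m - 1)).choose r ≤ exOrd n Q := by
  obtain ⟨G, hG, hGc⟩ := exists_free_graph hr (patternSign_eq a) n (m - 1)
  rw [Nat.sub_add_cancel hm] at hG
  exact hGc.trans ((exOrd_spec hr hm ha hQ).1 G hG)

end OrdHyp

open OrdHyp
theorem theorem1p9 :
    -- the general lower bound
    (∀ r n m : ℕ, 1 ≤ r → 1 ≤ n → 1 ≤ m →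
      ∀ P : OrderedGraph r (r * 2), P.IsPattern → P.IsPartite 2 →
      ∀ Q : OrderedGraph r (r * m), IsClique P m Q →
        n.choose r - (n - r * (m - 1)).choose r ≤ exOrd n Q) ∧
    -- the upper bound, with an absolute constant `C` and a threshold that depends only on `r`
    (∃ C : ℝ, 0 < C ∧ ∀ r : ℕ, 1 ≤ r → ∃ n₀ : ℕ, ∀ n : ℕ, n₀ ≤ n → ∀ m : ℕ, 1 ≤ m →
      ∀ P : OrderedGraph r (r * 2), P.IsPattern → P.IsPartite 2 →
      ∀ Q : OrderedGraph r (r * m), IsClique P m Q →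
        (exOrd n Q : ℝ) ≤ C * ((r : ℝ) ^ 2 * ((m : ℝ) - 1) * (n.choose (r - 1) : ℝ))) ∧
    -- the exact value for the alternating pattern
    (∀ r n m : ℕ, 1 ≤ r → 1 ≤ n → 1 ≤ m →
      ∀ Q : OrderedGraph r (r * m), IsClique (alternatingPattern r) m Q →
        exOrd n Q = n.choose r - (n - r * (m - 1)).choose r) := by
  refine ⟨?_, ⟨600, by norm_num, fun r hr => ⟨8 * r ^ 2, ?_⟩⟩, ?_⟩
  · intro r n m hr _ hm P hP hpart Q hQ
    obtain ⟨a, ha⟩ := pattern_eq hP hpart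
    exact le_exOrd hr hm ha hQ
  · intro n hn m hm P hP hpart Q hQ
    obtain ⟨a, ha⟩ := pattern_eq hP hpart
    obtain ⟨X, hX, hno, hXc⟩ := (exOrd_spec (n := n) hr hm ha hQ).2
    obtain ⟨K, rfl⟩ := Nat.exists_eq_add_of_le' hm
    have := card_le_of_not_hasChain hr (patternSign_eq a) hn
      (fun x hx => mem_coords_completeOrdered.1 (hX hx)) hno
    rw [hXc] at this
    rw [show ((K + 1 : ℕ) : ℝ) - 1 = K by push_cast; ring]
    exact_mod_cast this
  · intro r n m hr _ hm Q hQ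
    obtain ⟨a, ha, hsign⟩ := alternatingPattern_edges r
    refine le_antisymm ?_ (le_exOrd hr hm ha hQ)
    obtain ⟨X, hX, hno, hXc⟩ := (exOrd_spec (n := n) hr hm ha hQ).2
    rw [← hXc]
    refine card_le_of_not_hasChain_alternating hr hX ?_
    rwa [Nat.sub_add_cancel hm, ← hsign]
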